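/- Let $\mathbb{B}=\{q\in\mathbb{H}:|q|<1\}$ be the open unit ball of the quaternions, $\mathrm{Sp}(1)=\{u\in\mathbb{H}:|u|=1\}$, and $\mathrm{Sp}(1,1)=\{A\in M_2(\mathbb{H}): A^*I_{1,1}A=I_{1,1}\}$ with $I_{1,1}=\mathrm{diag}(1,-1)$, a Lie group embedded in $M_2(\mathbb{H})$. For functions on $\mathbb{B}$ with power series expansions $f(q)=\sum_n q^na_n$, $g(q)=\sum_n q^nb_n$ put $(f*g)(q)=\sum_n q^n\sum_{k=0}^n a_kb_{n-k}$, $f^c(q)=\sum_n q^n\overline{a_n}$, $f^s=f*f^c$ and $f^{-*}=\frac{1}{f^s}f^c$. For $A=\begin{pmatrix}a&c\\ b&d\end{pmatrix}\in\mathrm{Sp}(1,1)$ let $\mathcal{F}_A:\mathbb{B}\to\mathbb{B}$, $\mathcal{F}_A(q)=(qc+d)^{-*}*(qa+b)$, be the associated slice regular Möbius transformation; it is a bijection of $\mathbb{B}$. Let $\mathcal{M}(\mathbb{B})=\{\mathcal{F}_A:A\in\mathrm{Sp}(1,1)\}$, with the ($7$-dimensional, $C^\infty$) manifold structure for which $\mathrm{Sp}(1,1)\to\mathcal{M}(\mathbb{B})$,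 $A\mapsto\mathcal{F}_{A^{-1}}$, is a submersion (equivalently, for which the induced bijection $\mathrm{Sp}(1,1)/\mathrm{Sp}(1)I_2\to\mathcal{M}(\mathbb{B})$ is a diffeomorphism); such a structure exists. Let $\mathcal{M}(\mathbb{B})_0=\{\mathcal{F}\in\mathcal{M}(\mathbb{B}):\mathcal{F}(0)=0\}$. Then, for every such structure, $\mathcal{M}(\mathbb{B})_0$ is an embedded submanifold of $\mathcal{M}(\mathbb{B})$ and, with the composition of maps, a Lie group, and $u\mapsto(q\mapsto qu^{-1})$ is an isomorphism of Lie groups $\mathrm{Sp}(1)\to\mathcal{M}(\mathbb{B})_0$. The inverse orbit map $\mathcal{M}(\mathbb{B})\to\mathbb{B}$, $\mathcal{F}\mapsto\mathcal{F}^{-1}(0)$, is a globally trivial principal fiber bundle with structure group $\mathcal{M}(\mathbb{B})_0$ acting on the left by $(\mathcal{F}_0,\mathcal{F})\mapsto\mathcal{F}_0\circ\mathcal{F}$. That is: the map is a surjective submersion; the action is smooth, free and proper and its orbits are exactly the fibers of the map; the bundle is locally trivial; and there is a diffeomorphism $\Phi:\mathbb{B}\times\mathcal{M}(\mathbb{B})_0\to\mathcal{M}(\mathbb{B})$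 with $\Phi(x,\mathcal{G}\circ\mathcal{F}_0)=\mathcal{G}\circ\Phi(x,\mathcal{F}_0)$ and $\Phi(x,\mathcal{F}_0)^{-1}(0)=x$ for all $x\in\mathbb{B}$ and $\mathcal{F}_0,\mathcal{G}\in\mathcal{M}(\mathbb{B})_0$. -/

import Mathlib

open scoped Quaternion Matrix Manifold ContDiff

attribute [local instance] Matrix.linftyOpNormedRing Matrix.linftyOpNormedAlgebra

noncomputable section

/-! ### The Lie group `Sp(1,1)` -/

/-- The algebra `M₂(ℍ)`. -/
abbrev QMat : Type := Matrix (Fin 2) (Fin 2) ℍ[ℝ]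

/-- The topology of the normed algebra `M₂(ℍ)`; it is the product topology on the entries. -/
instance : TopologicalSpace QMat :=
  (inferInstance : NormedRing QMat).toSeminormedRing.toPseudoMetricSpace.toUniformSpace.toTopologicalSpace

/-- The matrix `I_{1,1} = diag(1, -1)`. -/
def I11 : QMat := !![1, 0; 0, -1]

theorem I11_mul_self : I11 * I11 = 1 := by
  refine Matrix.ext fun i j => ?_
  fin_cases i <;> fin_cases j <;> simp [I11, Matrix.mul_apply]

theorem I11_conjTranspose : I11ᴴ = I11 := by
  refine Matrix.ext fun i j => ?_
  fin_cases i <;> fin_cases j <;> simp [I11, Matrix.conjTranspose_apply]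

theorem I11_mul_cancel (X : QMat) : I11 * (I11 * X) = X := by
  rw [← mul_assoc, I11_mul_self, one_mul]

/-- `Sp(1,1) = {A ∈ M₂(ℍ) : A* I_{1,1} A = I_{1,1}}`, with the product of matrices. -/
def Sp11 : Submonoid QMat where
  carrier := {A | Aᴴ * I11 * A = I11}
  one_mem' := by simp
  mul_mem' := by
    intro A B hA hB
    simp only [Set.mem_ofPred_eq] at *
    calc (A * B)ᴴ * I11 * (A * B) = Bᴴ * (Aᴴ * I11 * A) * B := by
          rw [Matrix.conjTranspose_mul]; simp only [mul_assoc]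
      _ = I11 := by rw [hA, hB]

theorem Sp11.conj_mul_mul (A : Sp11) : (A : QMat)ᴴ * I11 * (A : QMat) = I11 := A.2

theorem Sp11.mul_mul_conj (A : Sp11) : (A : QMat) * I11 * (A : QMat)ᴴ = I11 := by
  have h : (I11 * (A : QMat)ᴴ * I11) * (A : QMat) = 1 := by
    rw [mul_assoc, mul_assoc, ← mul_assoc (A : QMat)ᴴ, Sp11.conj_mul_mul, I11_mul_self]
  have h2 := mul_eq_one_comm.1 h
  calc (A : QMat) * I11 * (A : QMat)ᴴ
      = ((A : QMat) * (I11 * (A : QMat)ᴴ * I11)) * I11 := by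
        simp only [mul_assoc, I11_mul_self, mul_one]
    _ = I11 := by rw [h2, one_mul]

instance : Inv Sp11 where
  inv A := ⟨I11 * (A : QMat)ᴴ * I11, by
    change (I11 * (A : QMat)ᴴ * I11)ᴴ * I11 * (I11 * (A : QMat)ᴴ * I11) = I11
    calc _ = I11 * ((A : QMat) * (I11 * I11) * I11 * (A : QMat)ᴴ) * I11 := by
          simp only [Matrix.conjTranspose_mul, Matrix.conjTranspose_conjTranspose,
            I11_conjTranspose, mul_assoc, I11_mul_cancel]
      _ = I11 := by
          rw [I11_mul_self, mul_one, Sp11.mul_mul_conj, I11_mul_self, one_mul]⟩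

instance : Group Sp11 :=
  { Submonoid.toMonoid Sp11 with
    inv := Inv.inv
    inv_mul_cancel := fun A => Subtype.ext (by
      change I11 * (A : QMat)ᴴ * I11 * (A : QMat) = 1
      rw [mul_assoc, mul_assoc, ← mul_assoc (A : QMat)ᴴ, Sp11.conj_mul_mul, I11_mul_self]) }

theorem conjTranspose_real_smul (r : ℝ) (X : QMat) : (r • X)ᴴ = r • Xᴴ :=
  Matrix.ext fun i j => by simp [Matrix.conjTranspose_apply]

theorem isUnit_two_smul {X : QMat} (h : IsUnit X) : IsUnit ((2 : ℝ) • X) := by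
  have : IsUnit ((Units.mk0 (2 : ℝ) two_ne_zero) • X) := (isUnit_smul_iff _ _).2 h
  exact this

/-- The Lie algebra `𝔰𝔭(1,1) = {X ∈ M₂(ℍ) : X* I_{1,1} + I_{1,1} X = 0}`, the model space of the
manifold `Sp(1,1)`. -/
def sp11 : Submodule ℝ QMat where
  carrier := {X | Xᴴ * I11 + I11 * X = 0}
  zero_mem' := by simp
  add_mem' := by
    intro X Y hX hY
    simp only [Set.mem_ofPred_eq] at *
    calc (X + Y)ᴴ * I11 + I11 * (X + Y) = (Xᴴ * I11 + I11 * X) + (Yᴴ * I11 + I11 * Y) := by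
          rw [Matrix.conjTranspose_add, add_mul, mul_add]; abel
      _ = 0 := by rw [hX, hY, add_zero]
  smul_mem' := by
    intro r X hX
    simp only [Set.mem_ofPred_eq] at *
    have h : (r • X)ᴴ = r • Xᴴ := conjTranspose_real_smul r X
    rw [h, smul_mul_assoc, mul_smul_comm, ← smul_add, hX, smul_zero]

/-- The linear projection `X ↦ (X - I_{1,1} X* I_{1,1}) / 2` of `M₂(ℍ)` onto `𝔰𝔭(1,1)`. -/
def sp11Proj : QMat →L[ℝ] sp11 :=
  LinearMap.toContinuousLinearMap
    { toFun := fun X => ⟨(1 / 2 : ℝ) • (X - I11 * Xᴴ * I11), sp11.smul_mem _ (by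
        change (X - I11 * Xᴴ * I11)ᴴ * I11 + I11 * (X - I11 * Xᴴ * I11) = 0
        simp only [Matrix.conjTranspose_sub, Matrix.conjTranspose_mul,
          Matrix.conjTranspose_conjTranspose, I11_conjTranspose, sub_mul, mul_sub, mul_assoc,
          I11_mul_self, I11_mul_cancel, mul_one]
        abel)⟩
      map_add' := fun X Y => Subtype.ext (by
        change (1 / 2 : ℝ) • (X + Y - I11 * (X + Y)ᴴ * I11)
          = (1 / 2 : ℝ) • (X - I11 * Xᴴ * I11) + (1 / 2 : ℝ) • (Y - I11 * Yᴴ * I11)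
        rw [← smul_add, Matrix.conjTranspose_add, mul_add, add_mul]
        congr 1
        abel)
      map_smul' := fun r X => Subtype.ext (by
        change (1 / 2 : ℝ) • (r • X - I11 * (r • X)ᴴ * I11)
          = r • ((1 / 2 : ℝ) • (X - I11 * Xᴴ * I11))
        have h : (r • X)ᴴ = r • Xᴴ := conjTranspose_real_smul r X
        rw [h, mul_smul_comm, smul_mul_assoc, ← smul_sub, smul_comm]) }

theorem sp11Proj_coe (X : QMat) (hX : X ∈ sp11) : (sp11Proj X : QMat) = X := by
  have h : Xᴴ * I11 = -(I11 * X) := eq_neg_of_add_eq_zero_left hX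
  change (1 / 2 : ℝ) • (X - I11 * Xᴴ * I11) = X
  rw [mul_assoc, h, mul_neg, I11_mul_cancel, sub_neg_eq_add, ← two_smul ℝ X, smul_smul]
  norm_num

/-- The Cayley transform `X ↦ (1 - X)(1 + X)⁻¹`. -/
def cayley (X : QMat) : QMat := (1 - X) * Ring.inverse (1 + X)

theorem cayley_add_one {X : QMat} (h : IsUnit (1 + X)) :
    1 + cayley X = (2 : ℝ) • Ring.inverse (1 + X) := by
  calc 1 + cayley X = (1 + X) * Ring.inverse (1 + X) + (1 - X) * Ring.inverse (1 + X) := by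
        rw [Ring.mul_inverse_cancel _ h, cayley]
    _ = (2 : ℝ) • Ring.inverse (1 + X) := by
        rw [← add_mul, two_smul]; simp only [add_mul, sub_mul, one_mul]; abel

theorem isUnit_cayley_add_one {X : QMat} (h : IsUnit (1 + X)) : IsUnit (1 + cayley X) := by
  rw [cayley_add_one h]
  exact isUnit_two_smul h.ringInverse

theorem cayley_cayley {X : QMat} (h : IsUnit (1 + X)) : cayley (cayley X) = X := by
  have h1 : 1 - cayley X = X * (1 + cayley X) := by
    rw [cayley_add_one h]
    calc 1 - cayley X = (1 + X) * Ring.inverse (1 + X) - (1 - X) * Ring.inverse (1 + X) := by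
          rw [Ring.mul_inverse_cancel _ h, cayley]
      _ = X * (2 : ℝ) • Ring.inverse (1 + X) := by
          rw [← sub_mul, two_smul]; simp only [add_mul, sub_mul, one_mul, mul_add]; abel
  rw [cayley, h1, mul_assoc, Ring.mul_inverse_cancel _ (isUnit_cayley_add_one h), mul_one]

theorem cayley_mem_Sp11 {X : QMat} (hX : X ∈ sp11) (h : IsUnit (1 + X)) : cayley X ∈ Sp11 := by
  have h0 : Xᴴ * I11 = -(I11 * X) := eq_neg_of_add_eq_zero_left hX
  have h1 : (1 - X)ᴴ * I11 = I11 * (1 + X) := by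
    rw [Matrix.conjTranspose_sub, Matrix.conjTranspose_one, sub_mul, h0, mul_add]; simp
  have h2 : (1 + X)ᴴ * I11 = I11 * (1 - X) := by
    rw [Matrix.conjTranspose_add, Matrix.conjTranspose_one, add_mul, h0, mul_sub]; simp
    abel
  have h3 : (Ring.inverse (1 + X))ᴴ * (1 + X)ᴴ = 1 := by
    rw [← Matrix.conjTranspose_mul, Ring.mul_inverse_cancel _ h, Matrix.conjTranspose_one]
  have h4 : (1 + X) * (1 - X) = (1 - X) * (1 + X) := by
    simp only [mul_add, mul_sub, add_mul, sub_mul, mul_one, one_mul]; abel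
  change (cayley X)ᴴ * I11 * cayley X = I11
  calc (cayley X)ᴴ * I11 * cayley X
      = (Ring.inverse (1 + X))ᴴ * (((1 - X)ᴴ * I11) * (1 - X)) * Ring.inverse (1 + X) := by
        rw [cayley, Matrix.conjTranspose_mul]; simp only [mul_assoc]
    _ = (Ring.inverse (1 + X))ᴴ * ((1 + X)ᴴ * I11) * ((1 + X) * Ring.inverse (1 + X)) := by
        rw [h1, mul_assoc I11, h4, ← mul_assoc I11, ← h2]; simp only [mul_assoc]
    _ = I11 := by
        rw [Ring.mul_inverse_cancel _ h, mul_one, ← mul_assoc, h3, one_mul]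

theorem cayley_mem_sp11 {A : QMat} (hA : A ∈ Sp11) (h : IsUnit (1 + A)) : cayley A ∈ sp11 := by
  have h0 : Aᴴ * I11 * A = I11 := hA
  have h3 : (Ring.inverse (1 + A))ᴴ * (1 + A)ᴴ = 1 := by
    rw [← Matrix.conjTranspose_mul, Ring.mul_inverse_cancel _ h, Matrix.conjTranspose_one]
  have h5 : (1 - A)ᴴ * I11 * (1 + A) + (1 + A)ᴴ * I11 * (1 - A) = 0 := by
    simp only [Matrix.conjTranspose_sub, Matrix.conjTranspose_add, Matrix.conjTranspose_one,
      sub_mul, add_mul, mul_add, mul_sub, one_mul, mul_one, h0]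
    abel
  change (cayley A)ᴴ * I11 + I11 * cayley A = 0
  calc (cayley A)ᴴ * I11 + I11 * cayley A
      = (Ring.inverse (1 + A))ᴴ * ((1 - A)ᴴ * I11) * ((1 + A) * Ring.inverse (1 + A))
        + ((Ring.inverse (1 + A))ᴴ * (1 + A)ᴴ) * I11 * ((1 - A) * Ring.inverse (1 + A)) := by
        rw [h3, Ring.mul_inverse_cancel _ h, cayley, Matrix.conjTranspose_mul]
        simp only [mul_assoc, one_mul, mul_one]
    _ = (Ring.inverse (1 + A))ᴴ * ((1 - A)ᴴ * I11 * (1 + A) + (1 + A)ᴴ * I11 * (1 - A))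
        * Ring.inverse (1 + A) := by
        simp only [mul_add, add_mul, mul_assoc]
    _ = 0 := by rw [h5]; simp

theorem contDiffOn_cayley : ContDiffOn ℝ ∞ cayley {X | IsUnit (1 + X)} := by
  rintro X ⟨u, hu⟩
  have h1 : ContDiffAt ℝ ∞ Ring.inverse (1 + X) := hu ▸ contDiffAt_ringInverse ℝ u
  have h2 : ContDiffAt ℝ ∞ (fun Y : QMat => Ring.inverse (1 + Y)) X :=
    ContDiffAt.comp (f := fun Y : QMat => 1 + Y) X h1 (contDiffAt_const.add contDiffAt_id)
  exact ((contDiffAt_const.sub contDiffAt_id).mul h2).contDiffWithinAt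

theorem isOpen_isUnit_one_add : IsOpen {X : QMat | IsUnit (1 + X)} :=
  Units.isOpen.preimage (continuous_const.add continuous_id)

open Classical in
/-- The chart of `Sp(1,1)` at the identity given by the Cayley transform. -/
def Sp11.chartOne : OpenPartialHomeomorph Sp11 sp11 where
  toFun A := sp11Proj (cayley A)
  invFun X := if h : IsUnit (1 + (X : QMat)) then ⟨cayley X, cayley_mem_Sp11 X.2 h⟩ else 1
  source := {A | IsUnit (1 + (A : QMat))}
  target := {X | IsUnit (1 + (X : QMat))}
  map_source' := by
    intro A hA
    change IsUnit (1 + ((sp11Proj (cayley A) : sp11) : QMat))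
    rw [sp11Proj_coe _ (cayley_mem_sp11 A.2 hA)]
    exact isUnit_cayley_add_one hA
  map_target' := by
    intro X hX
    have hX' : IsUnit (1 + (X : QMat)) := hX
    rw [dif_pos hX']
    exact isUnit_cayley_add_one hX'
  left_inv' := by
    intro A hA
    have h1 := sp11Proj_coe _ (cayley_mem_sp11 A.2 hA)
    have h2 : IsUnit (1 + ((sp11Proj (cayley A) : sp11) : QMat)) := by
      rw [h1]; exact isUnit_cayley_add_one hA
    rw [dif_pos h2]
    apply Subtype.ext
    change cayley ((sp11Proj (cayley A) : sp11) : QMat) = A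
    rw [h1, cayley_cayley hA]
  right_inv' := by
    intro X hX
    have hX' : IsUnit (1 + (X : QMat)) := hX
    rw [dif_pos hX']
    apply Subtype.ext
    change ((sp11Proj (cayley (cayley X)) : sp11) : QMat) = X
    rw [cayley_cayley hX', sp11Proj_coe _ X.2]
  open_source := isOpen_isUnit_one_add.preimage continuous_subtype_val
  open_target := isOpen_isUnit_one_add.preimage continuous_subtype_val
  continuousOn_toFun := sp11Proj.continuous.comp_continuousOn
    (contDiffOn_cayley.continuousOn.comp continuous_subtype_val.continuousOn fun _ h => h)
  continuousOn_invFun := by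
    rw [Topology.IsInducing.subtypeVal.continuousOn_iff]
    refine ContinuousOn.congr (f := fun X : sp11 => cayley X)
      (contDiffOn_cayley.continuousOn.comp continuous_subtype_val.continuousOn fun _ h => h) ?_
    intro X hX
    have hX' : IsUnit (1 + (X : QMat)) := hX
    simp only [Function.comp_apply]
    rw [dif_pos hX']

/-- The chart of `Sp(1,1)` at `g`: the left translate `A ↦ (1 - g⁻¹A)(1 + g⁻¹A)⁻¹` of the chart
at the identity. -/
def Sp11.chart (g : Sp11) : OpenPartialHomeomorph Sp11 sp11 :=
  (Homeomorph.mulLeft g⁻¹).toOpenPartialHomeomorph.trans Sp11.chartOne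

instance : ChartedSpace sp11 Sp11 where
  atlas := Set.range Sp11.chart
  chartAt := Sp11.chart
  mem_chart_source g := by
    simp only [Sp11.chart, Sp11.chartOne, OpenPartialHomeomorph.trans_source]
    refine ⟨trivial, ?_⟩
    change IsUnit (1 + ((g⁻¹ * g : Sp11) : QMat))
    rw [inv_mul_cancel]
    change IsUnit (1 + (1 : QMat))
    rw [← two_smul ℝ (1 : QMat)]
    exact isUnit_two_smul isUnit_one
  chart_mem_atlas g := ⟨g, rfl⟩

/-- The Cayley charts make `Sp(1,1)` a smooth manifold, embedded in `M₂(ℍ)`. -/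
instance : IsManifold 𝓘(ℝ, sp11) ∞ Sp11 := by
  refine isManifold_of_contDiffOn _ _ _ ?_
  classical
  rintro _ _ ⟨g, rfl⟩ ⟨g', rfl⟩
  have key : ContDiffOn ℝ ∞ (fun X : sp11 =>
      sp11Proj (cayley (((g'⁻¹ * g : Sp11) : QMat) * cayley (X : QMat))))
      {X | IsUnit (1 + (X : QMat)) ∧
        IsUnit (1 + ((g'⁻¹ * g : Sp11) : QMat) * cayley (X : QMat))} := by
    refine sp11Proj.contDiff.comp_contDiffOn (contDiffOn_cayley.comp ?_ fun X hX => hX.2)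
    refine contDiffOn_const.mul ?_
    exact contDiffOn_cayley.comp sp11.subtypeL.contDiff.contDiffOn fun X hX => hX.1
  have hval : ∀ X : sp11, IsUnit (1 + (X : QMat)) →
      ((g'⁻¹ * ((Sp11.chart g).symm X) : Sp11) : QMat)
        = ((g'⁻¹ * g : Sp11) : QMat) * cayley (X : QMat) := by
    intro X hX
    have h1 : (Sp11.chart g).symm X = g * ⟨cayley X, cayley_mem_Sp11 X.2 hX⟩ := by
      change g⁻¹⁻¹ * (if h : IsUnit (1 + (X : QMat)) then
        (⟨cayley X, cayley_mem_Sp11 X.2 h⟩ : Sp11) else 1) = _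
      rw [dif_pos hX, inv_inv]
    rw [h1, ← mul_assoc]
    rfl
  have hsub : ∀ X ∈ ((Sp11.chart g).symm ≫ₕ Sp11.chart g').source,
      IsUnit (1 + (X : QMat)) ∧
        IsUnit (1 + ((g'⁻¹ * g : Sp11) : QMat) * cayley (X : QMat)) := by
    intro X hX
    have hX1 : IsUnit (1 + (X : QMat)) := hX.1.1
    have hX2 : IsUnit (1 + ((g'⁻¹ * ((Sp11.chart g).symm X) : Sp11) : QMat)) := hX.2.2
    rw [hval X hX1] at hX2
    exact ⟨hX1, hX2⟩
  refine (key.mono fun X hX => hsub X hX.1).congr fun X hX => ?_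
  have hX1 := (hsub X hX.1).1
  change sp11Proj (cayley ((g'⁻¹ * ((Sp11.chart g).symm X) : Sp11) : QMat)) = _
  rw [hval X hX1]

/-! ### Slice regular functions on the unit ball and regular Möbius transformations -/

/-- The open unit ball `𝔹` of `ℍ`. -/
def QBall : TopologicalSpace.Opens ℍ[ℝ] := ⟨Metric.ball 0 1, Metric.isOpen_ball⟩

theorem QBall.norm_lt (q : QBall) : ‖(q : ℍ[ℝ])‖ < 1 := mem_ball_zero_iff.1 q.2

instance : Zero QBall := ⟨⟨0, Metric.mem_ball_self one_pos⟩⟩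

/-- `f` has the power series expansion `f(q) = ∑ qⁿ aₙ` on `𝔹`, with right coefficients. -/
def HasSliceExpansion (f : QBall → ℍ[ℝ]) (a : ℕ → ℍ[ℝ]) : Prop :=
  ∀ q : QBall, HasSum (fun n => (q : ℍ[ℝ]) ^ n * a n) (f q)

open Classical in
/-- The coefficients of the power series expansion of a slice regular function on `𝔹`
(and `0` for a function without such an expansion). -/
def sliceCoeff (f : QBall → ℍ[ℝ]) : ℕ → ℍ[ℝ] :=
  if h : ∃ a, HasSliceExpansion f a then h.choose else 0

/-- The regular product `(f * g)(q) = ∑ qⁿ (∑ₖ aₖ bₙ₋ₖ)`. -/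
def starMul (f g : QBall → ℍ[ℝ]) : QBall → ℍ[ℝ] := fun q =>
  ∑' n, (q : ℍ[ℝ]) ^ n * ∑ k ∈ Finset.range (n + 1), sliceCoeff f k * sliceCoeff g (n - k)

/-- The regular conjugate `fᶜ(q) = ∑ qⁿ (star aₙ)`. -/
def regConj (f : QBall → ℍ[ℝ]) : QBall → ℍ[ℝ] := fun q =>
  ∑' n, (q : ℍ[ℝ]) ^ n * star (sliceCoeff f n)

/-- The symmetrization `fˢ = f * fᶜ`. -/
def regSymm (f : QBall → ℍ[ℝ]) : QBall → ℍ[ℝ] := starMul f (regConj f)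

/-- The regular reciprocal `f^{-*} = (1 / fˢ) fᶜ`. -/
def starInv (f : QBall → ℍ[ℝ]) : QBall → ℍ[ℝ] := fun q => (regSymm f q)⁻¹ * regConj f q

/-- The function `l_{(a,b)}(q) = q a + b`. -/
def sliceAffine (a b : ℍ[ℝ]) : QBall → ℍ[ℝ] := fun q => (q : ℍ[ℝ]) * a + b

/-- For the matrix `A` with rows `(a, c)` and `(b, d)`, the function
`l_{(c,d)}^{-*} * l_{(a,b)}`, that is, `(q c + d)^{-*} * (q a + b)`. -/
def regMobiusFun (A : QMat) : QBall → ℍ[ℝ] :=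
  starMul (starInv (sliceAffine (A 0 1) (A 1 1))) (sliceAffine (A 0 0) (A 1 0))

/-- The real one-variable power series with coefficients `cₙ`. -/
def realSeries (c : ℕ → ℍ[ℝ]) : FormalMultilinearSeries ℝ ℝ ℍ[ℝ] :=
  fun n => ContinuousMultilinearMap.mkPiRing ℝ (Fin n) (c n)

theorem realSeries_coeff (c : ℕ → ℍ[ℝ]) (n : ℕ) : (realSeries c).coeff n = c n := by
  simp [FormalMultilinearSeries.coeff, realSeries]

theorem HasSliceExpansion.unique {f : QBall → ℍ[ℝ]} {a b : ℕ → ℍ[ℝ]}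
    (ha : HasSliceExpansion f a) (hb : HasSliceExpansion f b) : a = b := by
  classical
  have key : ∀ c : ℕ → ℍ[ℝ], HasSliceExpansion f c →
      HasFPowerSeriesAt (fun t : ℝ => if h : ((t : ℍ[ℝ])) ∈ QBall then f ⟨t, h⟩ else 0)
        (realSeries c) 0 := by
    intro c hc
    refine hasFPowerSeriesAt_iff.2 ?_
    filter_upwards [Metric.ball_mem_nhds (0 : ℝ) one_pos] with t ht
    have h : (t : ℍ[ℝ]) ∈ QBall := by
      change (t : ℍ[ℝ]) ∈ Metric.ball 0 1
      rw [mem_ball_zero_iff, Quaternion.norm_coe]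
      exact mem_ball_zero_iff.1 ht
    rw [zero_add, dif_pos h]
    have e := hc ⟨t, h⟩
    simp only [← Quaternion.coe_pow, Quaternion.coe_mul_eq_smul] at e
    simpa only [realSeries_coeff] using e
  have h := (key a ha).eq_formalMultilinearSeries (key b hb)
  funext n
  have h2 := congrArg (fun p => FormalMultilinearSeries.coeff p n) h
  simpa only [realSeries_coeff] using h2

theorem HasSliceExpansion.sliceCoeff_eq {f : QBall → ℍ[ℝ]} {a : ℕ → ℍ[ℝ]}
    (ha : HasSliceExpansion f a) : sliceCoeff f = a := by
  have h : ∃ a, HasSliceExpansion f a := ⟨a, ha⟩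
  rw [sliceCoeff, dif_pos h]
  exact h.choose_spec.unique ha

/-- The sequence `(b, a, 0, 0, …)`. -/
def affineCoeff (a b : ℍ[ℝ]) : ℕ → ℍ[ℝ]
  | 0 => b
  | 1 => a
  | _ + 2 => 0

theorem hasSum_affineCoeff (q a b : ℍ[ℝ]) :
    HasSum (fun n => q ^ n * affineCoeff a b n) (q * a + b) := by
  have h := hasSum_sum_of_ne_finset_zero (L := SummationFilter.unconditional ℕ)
    (s := Finset.range 2)
    (f := fun n => q ^ n * affineCoeff a b n) (by
      intro n hn
      match n, hn with
      | n + 2, _ => simp [affineCoeff]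
      | 0, h => simp at h
      | 1, h => simp at h)
  convert h using 1
  simp [Finset.sum_range_succ, affineCoeff, add_comm]

theorem sliceCoeff_affine (a b : ℍ[ℝ]) : sliceCoeff (sliceAffine a b) = affineCoeff a b :=
  HasSliceExpansion.sliceCoeff_eq fun q => hasSum_affineCoeff q a b

theorem regConj_affine (a b : ℍ[ℝ]) :
    regConj (sliceAffine a b) = sliceAffine (star a) (star b) := by
  funext q
  rw [regConj, sliceCoeff_affine]
  refine HasSum.tsum_eq ?_
  change HasSum _ ((q : ℍ[ℝ]) * star a + star b)
  convert hasSum_affineCoeff (q : ℍ[ℝ]) (star a) (star b) using 2 with n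
  match n with
  | 0 => rfl
  | 1 => rfl
  | n + 2 => simp [affineCoeff]

/-- Right multiplication of a power series by a polynomial of degree one. -/
theorem starMul_affine {f : QBall → ℍ[ℝ]} {e : ℕ → ℍ[ℝ]} (hf : HasSliceExpansion f e)
    (a b : ℍ[ℝ]) (q : QBall) :
    starMul f (sliceAffine a b) q = f q * b + q * f q * a := by
  rw [starMul, hf.sliceCoeff_eq, sliceCoeff_affine]
  have h1 : HasSum (fun n => (q : ℍ[ℝ]) ^ n * (e n * b)) (f q * b) := by
    simpa only [mul_assoc] using (hf q).mul_right b
  have h2 : HasSum (fun n => (q : ℍ[ℝ]) ^ (n + 1) * (e n * a)) (q * f q * a) := by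
    simpa only [mul_assoc, pow_succ'] using ((hf q).mul_left (q : ℍ[ℝ])).mul_right a
  refine HasSum.tsum_eq ?_
  rw [← hasSum_nat_add_iff' 1] at h1 ⊢
  convert h1.add h2 using 1
  · funext n
    rw [← mul_add, Finset.sum_range_succ, Finset.sum_range_succ]
    have h0 : ∑ k ∈ Finset.range n, e k * affineCoeff a b (n + 1 - k) = 0 := by
      refine Finset.sum_eq_zero fun k hk => ?_
      obtain ⟨m, hm⟩ : ∃ m, n + 1 - k = m + 2 := ⟨n - k - 1, by
        have := Finset.mem_range.1 hk; omega⟩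
      rw [hm]; simp [affineCoeff]
    rw [h0, zero_add]
    have h3 : n + 1 - n = 1 := by omega
    rw [h3, Nat.sub_self]
    simp only [affineCoeff]
    rw [add_comm (e n * a)]
  · simp [affineCoeff]
    abel

/-- The symmetrization of `q c + d`. -/
theorem regSymm_affine (c d : ℍ[ℝ]) (q : QBall) :
    regSymm (sliceAffine c d) q
      = (q * c + d) * star d + q * (q * c + d) * star c := by
  have h : HasSliceExpansion (sliceAffine c d) (affineCoeff c d) :=
    fun q => hasSum_affineCoeff q c d
  rw [regSymm, regConj_affine, starMul_affine h]
  rfl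

theorem regSymm_affine_real (c d q : ℍ[ℝ]) :
    (q * c + d) * star d + q * (q * c + d) * star c
      = q * q * ((Quaternion.normSq c : ℝ) : ℍ[ℝ]) + q * ((2 * (c * star d).re : ℝ) : ℍ[ℝ])
        + ((Quaternion.normSq d : ℝ) : ℍ[ℝ]) := by
  have h1 : c * star d + d * star c = ((2 * (c * star d).re : ℝ) : ℍ[ℝ]) := by
    ext <;> simp <;> ring
  rw [← h1, ← Quaternion.self_mul_star, ← Quaternion.self_mul_star]
  simp only [mul_add, add_mul, mul_assoc]
  abel

theorem regSymm_affine_eq (c d q : ℍ[ℝ]) :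
    (q * c + d) * star d + q * (q * c + d) * star c
      = (q * star c + star d) * d + q * (q * star c + star d) * c := by
  have h1 : star c * d + star d * c = ((2 * (c * star d).re : ℝ) : ℍ[ℝ]) := by
    ext <;> simp <;> ring
  rw [regSymm_affine_real, ← h1, ← Quaternion.star_mul_self, ← Quaternion.star_mul_self]
  simp only [mul_add, add_mul, mul_assoc]
  abel

theorem regSymm_affine_comm (c d q : ℍ[ℝ]) :
    Commute q ((q * c + d) * star d + q * (q * c + d) * star c) := by
  rw [regSymm_affine_real]
  have h (r : ℝ) : Commute q (r : ℍ[ℝ]) := (Quaternion.coe_commutes r q).symm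
  exact ((((Commute.refl q).mul_right (Commute.refl q)).mul_right (h _)).add_right
    ((Commute.refl q).mul_right (h _))).add_right (h _)

theorem affine_eq_zero {c d q x : ℍ[ℝ]} (hcd : ‖c‖ < ‖d‖) (hq : ‖q‖ < 1)
    (hx : x * d + q * x * c = 0) : x = 0 := by
  by_contra hne
  have h1 : ‖x‖ * ‖d‖ = ‖q‖ * ‖x‖ * ‖c‖ := by
    rw [← norm_mul, ← norm_mul, ← norm_mul, eq_neg_of_add_eq_zero_left hx, norm_neg]
  have h2 : 0 < ‖x‖ := norm_pos_iff.2 hne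
  have h3 : ‖q‖ * ‖c‖ ≤ 1 * ‖c‖ := mul_le_mul_of_nonneg_right hq.le (norm_nonneg c)
  nlinarith [mul_lt_mul_of_pos_left hcd h2]

theorem affine_conj_ne_zero {c d q : ℍ[ℝ]} (hcd : ‖c‖ < ‖d‖) (hq : ‖q‖ < 1) :
    q * star c + star d ≠ 0 := by
  intro h
  have h1 : ‖q‖ * ‖c‖ = ‖d‖ := by
    rw [← norm_star c, ← norm_mul, eq_neg_of_add_eq_zero_left h, norm_neg, norm_star]
  have h3 : ‖q‖ * ‖c‖ ≤ 1 * ‖c‖ := mul_le_mul_of_nonneg_right hq.le (norm_nonneg c)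
  linarith

theorem regSymm_affine_ne_zero {c d q : ℍ[ℝ]} (hcd : ‖c‖ < ‖d‖) (hq : ‖q‖ < 1) :
    (q * c + d) * star d + q * (q * c + d) * star c ≠ 0 := by
  rw [regSymm_affine_eq]
  exact fun h => affine_conj_ne_zero hcd hq (affine_eq_zero hcd hq h)

theorem hasSliceExpansion_starInv {c d : ℍ[ℝ]} (hcd : ‖c‖ < ‖d‖) :
    HasSliceExpansion (starInv (sliceAffine c d)) fun n => (-(d⁻¹ * c)) ^ n * d⁻¹ := by
  intro q
  have hd : d ≠ 0 := norm_pos_iff.1 ((norm_nonneg c).trans_lt hcd)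
  have hsum : Summable fun n : ℕ => (q : ℍ[ℝ]) ^ n * ((-(d⁻¹ * c)) ^ n * d⁻¹) := by
    have hr : ‖d⁻¹ * c‖ < 1 := by
      rw [norm_mul, norm_inv, inv_mul_lt_one₀ (norm_pos_iff.2 hd)]
      exact hcd
    refine Summable.of_norm_bounded
      ((summable_geometric_of_lt_one (norm_nonneg _) hr).mul_right ‖d⁻¹‖) fun n => ?_
    rw [norm_mul, norm_mul, norm_pow, norm_pow, norm_neg]
    calc ‖(q : ℍ[ℝ])‖ ^ n * (‖d⁻¹ * c‖ ^ n * ‖d⁻¹‖) ≤ 1 * (‖d⁻¹ * c‖ ^ n * ‖d⁻¹‖) :=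
          mul_le_mul_of_nonneg_right (pow_le_one₀ (norm_nonneg _) (QBall.norm_lt q).le) (by positivity)
      _ = _ := one_mul _
  obtain ⟨S, hS⟩ := hsum
  have h1 : S * d + q * S * c = 1 := by
    have e1 := hS.mul_right d
    have e2 := (hS.mul_left (q : ℍ[ℝ])).mul_right c
    rw [← hasSum_nat_add_iff' 1] at e1
    have e3 := e1.add e2
    have e4 : (fun n : ℕ => (q : ℍ[ℝ]) ^ (n + 1) * ((-(d⁻¹ * c)) ^ (n + 1) * d⁻¹) * d
        + q * ((q : ℍ[ℝ]) ^ n * ((-(d⁻¹ * c)) ^ n * d⁻¹)) * c) = fun _ => 0 := by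
      funext n
      have : (-(d⁻¹ * c)) ^ (n + 1) * d⁻¹ * d = -((-(d⁻¹ * c)) ^ n * d⁻¹ * c) := by
        rw [mul_assoc, inv_mul_cancel₀ hd, mul_one, pow_succ, mul_neg, ← mul_assoc]
      rw [mul_assoc _ _ d, this, pow_succ']
      simp only [mul_neg, mul_assoc]
      abel
    rw [e4] at e3
    have e5 := e3.unique hasSum_zero
    simp only [Finset.range_one, Finset.sum_singleton, pow_zero, one_mul,
      inv_mul_cancel₀ hd] at e5
    rw [← sub_eq_zero, ← e5]
    abel
  set N := ((q : ℍ[ℝ]) * c + d) * star d + q * (q * c + d) * star c with hN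
  have hN0 : N ≠ 0 := regSymm_affine_ne_zero hcd (QBall.norm_lt q)
  have hval : starInv (sliceAffine c d) q = N⁻¹ * (q * star c + star d) := by
    rw [starInv, regSymm_affine, regConj_affine]
    rfl
  have hcomm : Commute (q : ℍ[ℝ]) N⁻¹ := (regSymm_affine_comm c d q).inv_right₀
  have h2 : (N⁻¹ * (q * star c + star d)) * d + q * (N⁻¹ * (q * star c + star d)) * c = 1 := by
    rw [← mul_assoc (q : ℍ[ℝ]), hcomm.eq, mul_assoc, mul_assoc, mul_assoc, ← mul_add,
      ← mul_assoc (q : ℍ[ℝ]), ← regSymm_affine_eq, inv_mul_cancel₀ hN0]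
  have h3 : S - N⁻¹ * (q * star c + star d) = 0 := by
    refine affine_eq_zero hcd (QBall.norm_lt q) ?_
    rw [← sub_eq_zero.2 (h1.trans h2.symm)]
    simp only [sub_mul, mul_sub]
    abel
  rw [hval, ← sub_eq_zero.1 h3]
  exact hS

/-- Closed form of `(q c + d)^{-*} * (q a + b)`. -/
theorem regMobiusFun_eq {A : QMat} (hcd : ‖A 0 1‖ < ‖A 1 1‖) (q : QBall) :
    regMobiusFun A q
      = (((q : ℍ[ℝ]) * A 0 1 + A 1 1) * star (A 1 1)
          + q * (q * A 0 1 + A 1 1) * star (A 0 1))⁻¹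
        * ((q * star (A 0 1) + star (A 1 1)) * A 1 0
          + q * (q * star (A 0 1) + star (A 1 1)) * A 0 0) := by
  rw [regMobiusFun, starMul_affine (hasSliceExpansion_starInv hcd), starInv, regSymm_affine,
    regConj_affine]
  have hcomm := (regSymm_affine_comm (A 0 1) (A 1 1) (q : ℍ[ℝ])).inv_right₀
  change _ * ((q : ℍ[ℝ]) * star (A 0 1) + star (A 1 1)) * _
    + q * (_ * ((q : ℍ[ℝ]) * star (A 0 1) + star (A 1 1))) * _ = _
  rw [← mul_assoc (q : ℍ[ℝ]), hcomm.eq]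
  generalize (_ : ℍ[ℝ])⁻¹ = M
  simp only [mul_add, add_mul, mul_assoc]

theorem Sp11.entries (A : Sp11) :
    (A : QMat) 0 0 * star ((A : QMat) 0 0) - (A : QMat) 0 1 * star ((A : QMat) 0 1) = 1 ∧
    (A : QMat) 1 0 * star ((A : QMat) 1 0) - (A : QMat) 1 1 * star ((A : QMat) 1 1) = -1 ∧
    (A : QMat) 1 0 * star ((A : QMat) 0 0) - (A : QMat) 1 1 * star ((A : QMat) 0 1) = 0 := by
  have h := (Sp11.mul_mul_conj A)
  have h00 := congrFun (congrFun h 0) 0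
  have h11 := congrFun (congrFun h 1) 1
  have h10 := congrFun (congrFun h 1) 0
  simp [I11, Matrix.mul_apply, Fin.sum_univ_two, ← sub_eq_add_neg] at h00 h11 h10
  exact ⟨h00, h11, h10⟩

theorem Sp11.normSq_entries (A : Sp11) :
    Quaternion.normSq ((A : QMat) 0 0) - Quaternion.normSq ((A : QMat) 0 1) = 1 ∧
    Quaternion.normSq ((A : QMat) 1 0) - Quaternion.normSq ((A : QMat) 1 1) = -1 := by
  obtain ⟨h1, h2, -⟩ := (Sp11.entries A)
  rw [Quaternion.self_mul_star, Quaternion.self_mul_star] at h1 h2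
  have h3 := congrArg (fun x : ℍ[ℝ] => x.re) h1
  have h4 := congrArg (fun x : ℍ[ℝ] => x.re) h2
  exact ⟨by simpa using h3, by simpa using h4⟩

theorem Sp11.norm_lt (A : Sp11) : ‖(A : QMat) 0 1‖ < ‖(A : QMat) 1 1‖ := by
  have h := congrFun (congrFun (Sp11.conj_mul_mul A) 1) 1
  simp [I11, Matrix.mul_apply, Fin.sum_univ_two] at h
  rw [Quaternion.star_mul_self, Quaternion.star_mul_self] at h
  have h2 : Quaternion.normSq ((A : QMat) 0 1) + -Quaternion.normSq ((A : QMat) 1 1) = -1 := by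
    simpa using congrArg (fun x : ℍ[ℝ] => x.re) h
  rw [Quaternion.normSq_eq_norm_mul_self, Quaternion.normSq_eq_norm_mul_self] at h2
  nlinarith [norm_nonneg ((A : QMat) 0 1), norm_nonneg ((A : QMat) 1 1)]

theorem regMobiusFun_mem (A : Sp11) (q : QBall) : regMobiusFun A q ∈ QBall := by
  obtain ⟨h1, h2⟩ := (Sp11.normSq_entries A)
  have h3 := (Sp11.entries A).2.2
  have hcd := (Sp11.norm_lt A)
  have hh := affine_conj_ne_zero hcd (QBall.norm_lt q)
  have hN := regSymm_affine_ne_zero hcd (QBall.norm_lt q)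
  have hq := (QBall.norm_lt q)
  change _ ∈ Metric.ball (0 : ℍ[ℝ]) 1
  rw [mem_ball_zero_iff, regMobiusFun_eq hcd, norm_mul, norm_inv,
    inv_mul_lt_one₀ (norm_pos_iff.2 hN)]
  rw [regSymm_affine_eq]
  set a := (A : QMat) 0 0
  set b := (A : QMat) 1 0
  set c := (A : QMat) 0 1
  set d := (A : QMat) 1 1
  set h := (q : ℍ[ℝ]) * star c + star d
  have hpos : 0 < Quaternion.normSq h :=
    lt_of_le_of_ne Quaternion.normSq_nonneg fun h0 => hh (Quaternion.normSq_eq_zero.1 h0.symm)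
  have hq2 : Quaternion.normSq (q : ℍ[ℝ]) < 1 := by
    rw [Quaternion.normSq_eq_norm_mul_self]
    nlinarith [norm_nonneg (q : ℍ[ℝ])]
  have hcross : h * b * star (q * h * a) = h * d * star (q * h * c) := by
    have : b * star a = d * star c := sub_eq_zero.1 h3
    simp only [star_mul]
    calc h * b * (star a * (star h * star (q : ℍ[ℝ])))
        = h * (b * star a) * (star h * star (q : ℍ[ℝ])) := by simp only [mul_assoc]
      _ = _ := by rw [this]; simp only [mul_assoc]
  have key : Quaternion.normSq (h * d + (q : ℍ[ℝ]) * h * c) - Quaternion.normSq (h * b + (q : ℍ[ℝ]) * h * a)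
      = Quaternion.normSq h * (1 - Quaternion.normSq (q : ℍ[ℝ])) := by
    rw [Quaternion.normSq_add, Quaternion.normSq_add, hcross]
    simp only [map_mul]
    linear_combination (-Quaternion.normSq h) * h2
      - Quaternion.normSq (q : ℍ[ℝ]) * Quaternion.normSq h * h1
  have key2 : Quaternion.normSq (h * b + (q : ℍ[ℝ]) * h * a) < Quaternion.normSq (h * d + (q : ℍ[ℝ]) * h * c) := by
    have := mul_pos hpos (sub_pos.2 hq2)
    linarith
  rw [Quaternion.normSq_eq_norm_mul_self, Quaternion.normSq_eq_norm_mul_self] at key2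
  exact lt_of_mul_self_lt_mul_self₀ (norm_nonneg _) key2

/-- The regular Möbius transformation `𝓕_A : 𝔹 → 𝔹`, `𝓕_A(q) = (q c + d)^{-*} * (q a + b)`, of the
matrix `A ∈ Sp(1,1)` with rows `(a, c)` and `(b, d)`. -/
def mobius (A : Sp11) (q : QBall) : QBall := ⟨regMobiusFun A q, regMobiusFun_mem A q⟩

/-- The set `𝓜(𝔹) = {𝓕_A : A ∈ Sp(1,1)}` of all regular Möbius transformations of `𝔹`. -/
def RegMobius : Type := {F : QBall → QBall // ∃ A : Sp11, F = mobius A}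

instance : CoeFun RegMobius fun _ => QBall → QBall := ⟨Subtype.val⟩

@[ext]
theorem RegMobius.ext {F G : RegMobius} (h : ∀ q, F q = G q) : F = G :=
  Subtype.ext (funext h)

/-- The map `Sp(1,1) → 𝓜(𝔹)`, `A ↦ 𝓕_{A⁻¹}`. -/
def mobiusInvMap (A : Sp11) : RegMobius := ⟨mobius A⁻¹, A⁻¹, rfl⟩

/-- The group `Sp(1)` of unit quaternions, with Mathlib's manifold structure on the sphere. -/
abbrev Sp1 : Type := Metric.sphere (0 : ℍ[ℝ]) 1

instance : Fact (Module.finrank ℝ ℍ[ℝ] = 3 + 1) := ⟨Quaternion.finrank_eq_four⟩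

/-- The diagonal matrix `diag(u, 1)`. -/
def diagSp11 (u : Sp1) : Sp11 := ⟨!![(u : ℍ[ℝ]), 0; 0, 1], by
  have h : star (u : ℍ[ℝ]) * u = 1 := by
    rw [Quaternion.star_mul_self, Quaternion.normSq_eq_norm_mul_self, mem_sphere_zero_iff_norm.1 u.2]
    simp
  change _ * I11 * _ = I11
  refine Matrix.ext fun i j => ?_
  fin_cases i <;> fin_cases j <;> simp [I11, Matrix.mul_apply, Fin.sum_univ_two, h]⟩

/-- Right multiplication by a unit quaternion on values corresponds to `A ↦ A diag(u, 1)`. -/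
theorem mobius_mul_diag (A : Sp11) (u : Sp1) (q : QBall) :
    (mobius (A * diagSp11 u) q : ℍ[ℝ]) = mobius A q * u := by
  have e1 : ((A * diagSp11 u : Sp11) : QMat) 0 1 = (A : QMat) 0 1 := by
    simp [diagSp11, Matrix.mul_apply, Fin.sum_univ_two]
  have e2 : ((A * diagSp11 u : Sp11) : QMat) 1 1 = (A : QMat) 1 1 := by
    simp [diagSp11, Matrix.mul_apply, Fin.sum_univ_two]
  have e3 : ((A * diagSp11 u : Sp11) : QMat) 0 0 = (A : QMat) 0 0 * u := by
    simp [diagSp11, Matrix.mul_apply, Fin.sum_univ_two]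
  have e4 : ((A * diagSp11 u : Sp11) : QMat) 1 0 = (A : QMat) 1 0 * u := by
    simp [diagSp11, Matrix.mul_apply, Fin.sum_univ_two]
  change regMobiusFun _ q = regMobiusFun _ q * u
  rw [regMobiusFun_eq (Sp11.norm_lt _), regMobiusFun_eq (Sp11.norm_lt A), e1, e2, e3, e4]
  generalize (_ : ℍ[ℝ])⁻¹ = M
  simp only [add_mul, mul_assoc]

theorem mobius_one (q : QBall) : mobius 1 q = q := by
  refine Subtype.ext ?_
  change regMobiusFun _ q = q
  rw [regMobiusFun_eq (Sp11.norm_lt 1)]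
  simp

/-- The isotropy `𝓜(𝔹)₀ = {𝓕 ∈ 𝓜(𝔹) : 𝓕(0) = 0}`, with the subspace topology whenever `𝓜(𝔹)` is
given a topology. -/
abbrev RegMobiusZero : Type := {F : RegMobius // F 0 = 0}

/-- The transformation `R_u(q) = q u`. -/
def rightMul (u : Sp1) : RegMobiusZero :=
  ⟨⟨mobius (diagSp11 u), diagSp11 u, rfl⟩, by
    refine Subtype.ext ?_
    change (mobius (diagSp11 u) 0 : ℍ[ℝ]) = 0
    rw [← one_mul (diagSp11 u), mobius_mul_diag, mobius_one]
    exact zero_mul _⟩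

theorem rightMul_apply (u : Sp1) (q : QBall) : ((rightMul u).1 q : ℍ[ℝ]) = q * u := by
  change (mobius (diagSp11 u) q : ℍ[ℝ]) = q * u
  rw [← one_mul (diagSp11 u), mobius_mul_diag, mobius_one]

theorem exists_eq_rightMul (F : RegMobiusZero) : ∃ u : Sp1, F = rightMul u := by
  obtain ⟨⟨F, A, rfl⟩, hF⟩ := F
  obtain ⟨h1, h2⟩ := Sp11.normSq_entries A
  have h3 := (Sp11.entries A).2.2
  have hcd := Sp11.norm_lt A
  have hd : (A : QMat) 1 1 ≠ 0 := norm_pos_iff.1 ((norm_nonneg _).trans_lt hcd)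
  have hb : (A : QMat) 1 0 = 0 := by
    have h := congrArg (fun q : QBall => (q : ℍ[ℝ])) hF
    change regMobiusFun _ 0 = 0 at h
    rw [regMobiusFun_eq hcd] at h
    have hz : ((0 : QBall) : ℍ[ℝ]) = 0 := rfl
    simpa [hz, hd] using h
  rw [hb] at h2 h3
  have hc : (A : QMat) 0 1 = 0 := by simpa [hd] using h3
  have hdn : Quaternion.normSq ((A : QMat) 1 1) = 1 := by simp at h2; linarith
  have han : Quaternion.normSq ((A : QMat) 0 0) = 1 := by rw [hc] at h1; simpa using h1
  have hu : ‖star ((A : QMat) 1 1) * (A : QMat) 0 0‖ = 1 := by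
    rw [norm_mul, norm_star]
    rw [Quaternion.normSq_eq_norm_mul_self] at hdn han
    rw [(mul_self_eq_one_iff.1 hdn).resolve_right fun h => by
        linarith [norm_nonneg ((A : QMat) 1 1)],
      (mul_self_eq_one_iff.1 han).resolve_right fun h => by
        linarith [norm_nonneg ((A : QMat) 0 0)], one_mul]
  refine ⟨⟨star ((A : QMat) 1 1) * (A : QMat) 0 0, mem_sphere_zero_iff_norm.2 hu⟩, ?_⟩
  refine Subtype.ext (RegMobius.ext fun q => Subtype.ext ?_)
  rw [rightMul_apply]
  change regMobiusFun _ q = _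
  rw [regMobiusFun_eq hcd, hb, hc]
  have hdd : (A : QMat) 1 1 * star ((A : QMat) 1 1) = 1 := by
    rw [Quaternion.self_mul_star, hdn]; rfl
  simp [hdd, mul_assoc]

/-- The left action of `𝓜(𝔹)₀` on `𝓜(𝔹)` by composition, `(𝓕₀, 𝓕) ↦ 𝓕₀ ∘ 𝓕`. -/
instance : SMul RegMobiusZero RegMobius where
  smul F₀ F := ⟨F₀.1.1 ∘ F.1, by
    obtain ⟨u, rfl⟩ := exists_eq_rightMul F₀
    obtain ⟨F, A, rfl⟩ := F
    refine ⟨A * diagSp11 u, funext fun q => Subtype.ext ?_⟩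
    rw [mobius_mul_diag]
    exact rightMul_apply u _⟩

/-- `𝓜(𝔹)₀` is a group for the composition of maps. -/
instance : Group RegMobiusZero where
  mul F G := ⟨⟨F.1.1 ∘ G.1.1, (F • G.1).2⟩, by
    change F.1 (G.1 0) = 0
    rw [G.2, F.2]⟩
  mul_assoc _ _ _ := rfl
  one := ⟨⟨id, 1, funext fun q => (mobius_one q).symm⟩, rfl⟩
  one_mul _ := rfl
  mul_one _ := rfl
  inv F := rightMul (exists_eq_rightMul F).choose⁻¹
  inv_mul_cancel F := by
    refine Subtype.ext (RegMobius.ext fun q => Subtype.ext ?_)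
    change ((rightMul (exists_eq_rightMul F).choose⁻¹).1 (F.1 q) : ℍ[ℝ]) = q
    have h := (exists_eq_rightMul F).choose_spec
    have h2 : (F.1 q : ℍ[ℝ]) = q * (exists_eq_rightMul F).choose := by
      rw [← rightMul_apply, ← h]
    rw [rightMul_apply, h2, mul_assoc]
    have h3 : (((exists_eq_rightMul F).choose * (exists_eq_rightMul F).choose⁻¹ : Sp1) : ℍ[ℝ])
        = 1 := by rw [mul_inv_cancel]; rfl
    change (q : ℍ[ℝ]) * (((exists_eq_rightMul F).choose * (exists_eq_rightMul F).choose⁻¹ : Sp1) :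
      ℍ[ℝ]) = q
    rw [h3, mul_one]

instance : MulAction RegMobiusZero RegMobius where
  one_smul _ := rfl
  mul_smul _ _ _ := rfl

/-- The inverse orbit map `𝓜(𝔹) → 𝔹`, `𝓕 ↦ 𝓕⁻¹(0)`. -/
def inverseOrbit (F : RegMobius) : QBall := Function.invFun F 0

/-! ### Submersions and principal fiber bundles -/

section Bundles

variable {EG HG EP HP EB HB : Type*}
  [NormedAddCommGroup EG] [NormedSpace ℝ EG] [TopologicalSpace HG]
  [NormedAddCommGroup EP] [NormedSpace ℝ EP] [TopologicalSpace HP]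
  [NormedAddCommGroup EB] [NormedSpace ℝ EB] [TopologicalSpace HB]
  (IG : ModelWithCorners ℝ EG HG) (IP : ModelWithCorners ℝ EP HP) (IB : ModelWithCorners ℝ EB HB)
  (G : Type*) {P B : Type*}
  [TopologicalSpace G] [ChartedSpace HG G] [Group G]
  [TopologicalSpace P] [ChartedSpace HP P]
  [TopologicalSpace B] [ChartedSpace HB B] [MulAction G P]

/-- A submersion: a surjective smooth map whose differential at every point is surjective. -/
structure IsSurjectiveSubmersion (π : P → B) : Prop where
  contMDiff : ContMDiff IP IB ∞ π
  surjective : Function.Surjective π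
  mfderiv_surjective : ∀ p, Function.Surjective (mfderiv IP IB π p)

/-- `π : P → B` is a principal fiber bundle with structure Lie group `G` acting on the left on the
total space `P`. -/
structure IsLeftPrincipalBundle (π : P → B) : Prop where
  manifold_total : IsManifold IP ∞ P
  manifold_base : IsManifold IB ∞ B
  lieGroup : LieGroup IG ∞ G
  submersion : IsSurjectiveSubmersion IP IB π
  smooth_action : ContMDiff (IG.prod IP) IP ∞ fun x : G × P => x.1 • x.2
  free : ∀ (g : G) (p : P), g • p = p → g = 1
  proper : ∀ K : Set P, IsCompact K → IsCompact {g : G | (((g • ·) '' K) ∩ K).Nonempty}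
  fibers : ∀ p p' : P, π p = π p' ↔ ∃ g : G, g • p = p'
  /-- Around every point of `B` there are an open set `U` and a `G`-equivariant diffeomorphism of
  `U × G` onto `π⁻¹(U)` over `U`. -/
  locally_trivial : ∀ b : B, ∃ U : Set B, IsOpen U ∧ b ∈ U ∧
    ∃ φ : OpenPartialHomeomorph (B × G) P,
      φ.source = U ×ˢ Set.univ ∧ φ.target = π ⁻¹' U ∧
      ContMDiffOn (IB.prod IG) IP ∞ φ φ.source ∧
      ContMDiffOn IP (IB.prod IG) ∞ φ.symm φ.target ∧
      (∀ x ∈ U, ∀ g : G, π (φ (x, g)) = x) ∧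
      (∀ x ∈ U, ∀ g h : G, φ (x, g * h) = g • φ (x, h))

/-- The bundle is globally trivial: there is a `G`-equivariant diffeomorphism of `B × G` onto `P`
over `B`. -/
def IsGloballyTrivial (π : P → B) : Prop :=
  ∃ φ : Diffeomorph (IB.prod IG) IP (B × G) P ∞,
    (∀ (x : B) (g : G), π (φ (x, g)) = x) ∧
    (∀ (x : B) (g h : G), φ (x, g * h) = g • φ (x, h))

end Bundles

/-- The topology and the atlas make `𝓜(𝔹)` a `7`-dimensional smooth manifold for which
`Sp(1,1) → 𝓜(𝔹)`, `A ↦ 𝓕_{A⁻¹}`, is a submersion. As the fibers of this map are the cosets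
`A Sp(1) I₂`, this means that the bijection `Sp(1,1)/Sp(1)I₂ → 𝓜(𝔹)` is a diffeomorphism for the
quotient manifold structure on `Sp(1,1)/Sp(1)I₂`. -/
structure IsQuotientManifold [TopologicalSpace RegMobius]
    [ChartedSpace (EuclideanSpace ℝ (Fin 7)) RegMobius] : Prop where
  manifold : IsManifold (𝓡 7) ∞ RegMobius
  hausdorff : T2Space RegMobius
  second_countable : SecondCountableTopology RegMobius
  submersion : IsSurjectiveSubmersion 𝓘(ℝ, sp11) (𝓡 7) mobiusInvMap

end


/-!
Every `A ∈ Sp(1,1)` is a boost `(1 - |x|²)^{-1/2} (w, w x̄; x, 1)` times a scalar matrix `v I₂`,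
and `𝓕_{A⁻¹}` does not see `v`: it is `q ↦ (1 - q x̄)^{-*} * (q - x)` followed by right
multiplication by `w̄`. The first factor vanishes only at `x`, and it is a bijection of the ball
because it is a classical Möbius transformation precomposed with `q ↦ (1 - q x)⁻¹ q (1 - q x)`,
which is invertible by the same formula with `x̄` in place of `x`. So a regular Möbius
transformation is the same thing as the pair `(x, w)` of its zero and a unit quaternion. Both the
coordinates `A ↦ (x, w)` and the boost section are smooth; as smoothness of a map out of the
target of a submersion can be tested upstairs, `(x, w) ↦ 𝓕_{A⁻¹}` is a diffeomorphism `𝔹 × Sp(1) →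
𝓜(𝔹)` for every quotient structure. Composition with an element of `𝓜(𝔹)₀` only multiplies `w`, so
this diffeomorphism is a global trivialization, and `𝓜(𝔹)₀` is its slice `x = 0`. Properness is
automatic, `Sp(1)` being compact.
-/

theorem one_sub_mul_ne_zero {R : Type*} [NormedRing R] [NormOneClass R] {q x : R}
    (hq : ‖q‖ < 1) (hx : ‖x‖ < 1) : 1 - q * x ≠ 0 := by
  intro h
  have hqx : 1 ≤ ‖q‖ * ‖x‖ := by
    rw [← norm_one (α := R), sub_eq_zero.1 h]
    exact norm_mul_le q x
  exact hqx.not_gt (mul_lt_one_of_nonneg_of_lt_one_left (norm_nonneg q) hq hx.le)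

theorem one_sub_norm_sq_pos {E : Type*} [SeminormedAddGroup E] {x : E} (hx : ‖x‖ < 1) :
    0 < 1 - ‖x‖ ^ 2 :=
  sub_pos.2 (pow_lt_one₀ (norm_nonneg x) hx two_ne_zero)

/-- Conjugation of `q` by `1 - q x`, the twist that relates slice regular Möbius transformations to
classical ones. -/
noncomputable def conjTwist {R : Type*} [DivisionRing R] (x q : R) : R :=
  (1 - q * x)⁻¹ * (q * (1 - q * x))

section DivisionRing

variable {R : Type*} [DivisionRing R] {x q : R}

theorem one_sub_mul_conjTwist (h : 1 - q * x ≠ 0) :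
    (1 - q * x) * conjTwist x q = q * (1 - q * x) :=
  mul_inv_cancel_left₀ h _

theorem conjTwist_self (h : 1 - x * x ≠ 0) : conjTwist x x = x := by
  rw [conjTwist, inv_mul_eq_iff_eq_mul₀ h, mul_sub, sub_mul, mul_one, one_mul, mul_assoc]

end DivisionRing

theorem norm_conjTwist {R : Type*} [NormedDivisionRing R] {x q : R} (h : 1 - q * x ≠ 0) :
    ‖conjTwist x q‖ = ‖q‖ := by
  rw [conjTwist, norm_mul, norm_mul, norm_inv, mul_comm ‖q‖,
    inv_mul_cancel_left₀ (norm_ne_zero_iff.2 h)]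

/-- The classical Möbius transformation of the unit ball of `ℍ` that sends `x` to `0`. -/
noncomputable def classicalMobius (x p : ℍ[ℝ]) : ℍ[ℝ] := (1 - p * star x)⁻¹ * (p - x)

/-- The slice regular Möbius transformation `(1 - q x̄)^{-*} * (q - x)`, encoded without slice
products as a classical Möbius transformation of `conjTwist x q`. -/
noncomputable def regularMobius (x q : ℍ[ℝ]) : ℍ[ℝ] := classicalMobius x (conjTwist x q)

section QuaternionBall

variable {x p q : ℍ[ℝ]}

theorem conjTwist_star_conjTwist (hx : ‖x‖ < 1) (hq : ‖q‖ < 1) :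
    conjTwist (star x) (conjTwist x q) = q := by
  have hqx := one_sub_mul_ne_zero hq hx
  have hp : ‖conjTwist x q‖ < 1 := (norm_conjTwist hqx).trans_lt hq
  rw [conjTwist, inv_mul_eq_iff_eq_mul₀ (one_sub_mul_ne_zero hp (by rwa [norm_star]))]
  apply mul_left_cancel₀ hqx
  have hcomm : Commute q ((1 - q * x) * (1 - conjTwist x q * star x)) := by
    have h := regSymm_affine_comm (-x) 1 q
    rwa [mul_neg, neg_add_eq_sub, star_one, mul_one, star_neg, mul_neg, ← sub_eq_add_neg,
      ← one_sub_mul_conjTwist hqx, mul_assoc, ← mul_one_sub] at h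
  rw [← mul_assoc, one_sub_mul_conjTwist hqx, mul_assoc, hcomm.eq, mul_assoc]

theorem norm_classicalMobius_lt_one (hx : ‖x‖ < 1) (hp : ‖p‖ < 1) : ‖classicalMobius x p‖ < 1 := by
  have hinner : inner ℝ (1 : ℍ[ℝ]) (p * star x) = inner ℝ p x := by
    rw [real_inner_comm x p, Quaternion.inner_def, Quaternion.inner_def, one_mul, star_mul,
      star_star]
  have hsq : ‖1 - p * star x‖ ^ 2 - ‖p - x‖ ^ 2 = (1 - ‖p‖ ^ 2) * (1 - ‖x‖ ^ 2) := by
    rw [norm_sub_sq_real, norm_sub_sq_real, hinner, norm_mul, norm_star, norm_one]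
    ring
  rw [classicalMobius, norm_mul, norm_inv,
    inv_mul_lt_one₀ (norm_pos_iff.2 (one_sub_mul_ne_zero hp (by rwa [norm_star])))]
  refine lt_of_pow_lt_pow_left₀ 2 (norm_nonneg _) (sub_pos.1 ?_)
  rw [hsq]
  exact mul_pos (one_sub_norm_sq_pos hp) (one_sub_norm_sq_pos hx)

theorem classicalMobius_neg_classicalMobius (hx : ‖x‖ < 1) (hp : ‖p‖ < 1) :
    classicalMobius (-x) (classicalMobius x p) = p := by
  have hx' : ‖star x‖ < 1 := by rwa [norm_star]
  have hy := norm_classicalMobius_lt_one hx hp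
  have hmul : (1 - p * star x) * classicalMobius x p = p - x :=
    mul_inv_cancel_left₀ (one_sub_mul_ne_zero hp hx') _
  set y := classicalMobius x p
  rw [classicalMobius,
    inv_mul_eq_iff_eq_mul₀ (one_sub_mul_ne_zero hy (by rwa [norm_star, norm_neg]))]
  apply mul_left_cancel₀ (one_sub_mul_ne_zero hp hx')
  have hcomm : star x * x * p = p * (star x * x) := by
    rw [Quaternion.star_mul_self, Quaternion.coe_commutes]
  calc (1 - p * star x) * (y - -x) = p - p * (star x * x) := by
        rw [mul_sub, hmul, mul_neg, sub_mul, one_mul, mul_assoc]; abel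
    _ = (1 - p * star x + (p - x) * star x) * p := by
        rw [sub_mul p, sub_add_sub_cancel, sub_mul, one_mul, ← hcomm, star_comm_self']
    _ = (1 - p * star x) * ((1 - y * star (-x)) * p) := by
        rw [← hmul, star_neg, mul_neg, sub_neg_eq_add, ← mul_assoc _ _ p, mul_add, mul_one,
          mul_assoc _ y]

theorem bijOn_conjTwist (hx : ‖x‖ < 1) :
    Set.BijOn (conjTwist x) (Metric.ball 0 1) (Metric.ball 0 1) := by
  have hmaps {z : ℍ[ℝ]} (hz : ‖z‖ < 1) :
      Set.MapsTo (conjTwist z) (Metric.ball 0 1) (Metric.ball 0 1) := fun q hq => by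
    rw [mem_ball_zero_iff] at hq ⊢
    rwa [norm_conjTwist (one_sub_mul_ne_zero hq hz)]
  have hleft {z : ℍ[ℝ]} (hz : ‖z‖ < 1) :
      Set.LeftInvOn (conjTwist (star z)) (conjTwist z) (Metric.ball 0 1) := fun q hq =>
    conjTwist_star_conjTwist hz (mem_ball_zero_iff.1 hq)
  have hx' : ‖star x‖ < 1 := by rwa [norm_star]
  exact Set.InvOn.bijOn ⟨hleft hx, by simpa only [star_star] using hleft hx'⟩ (hmaps hx) (hmaps hx')

theorem bijOn_classicalMobius (hx : ‖x‖ < 1) :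
    Set.BijOn (classicalMobius x) (Metric.ball 0 1) (Metric.ball 0 1) := by
  have hmaps {z : ℍ[ℝ]} (hz : ‖z‖ < 1) :
      Set.MapsTo (classicalMobius z) (Metric.ball 0 1) (Metric.ball 0 1) := fun p hp =>
    mem_ball_zero_iff.2 (norm_classicalMobius_lt_one hz (mem_ball_zero_iff.1 hp))
  have hleft {z : ℍ[ℝ]} (hz : ‖z‖ < 1) :
      Set.LeftInvOn (classicalMobius (-z)) (classicalMobius z) (Metric.ball 0 1) := fun p hp =>
    classicalMobius_neg_classicalMobius hz (mem_ball_zero_iff.1 hp)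
  have hx' : ‖-x‖ < 1 := by rwa [norm_neg]
  exact Set.InvOn.bijOn ⟨hleft hx, by simpa only [neg_neg] using hleft hx'⟩ (hmaps hx) (hmaps hx')

theorem bijOn_regularMobius (hx : ‖x‖ < 1) :
    Set.BijOn (regularMobius x) (Metric.ball 0 1) (Metric.ball 0 1) :=
  (bijOn_classicalMobius hx).comp (bijOn_conjTwist hx)

theorem regularMobius_self (hx : ‖x‖ < 1) : regularMobius x x = 0 := by
  rw [regularMobius, conjTwist_self (one_sub_mul_ne_zero hx hx), classicalMobius, sub_self,
    mul_zero]

theorem regularMobius_eq (h : 1 - q * x ≠ 0) :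
    regularMobius x q = (1 - q * x - q * (1 - q * x) * star x)⁻¹
      * (q * (1 - q * x) - (1 - q * x) * x) := by
  have hden : 1 - q * x - q * (1 - q * x) * star x
      = (1 - q * x) * (1 - conjTwist x q * star x) := by
    rw [mul_one_sub (1 - q * x), ← mul_assoc, one_sub_mul_conjTwist h]
  have hnum : q * (1 - q * x) - (1 - q * x) * x = (1 - q * x) * (conjTwist x q - x) := by
    rw [mul_sub (1 - q * x), one_sub_mul_conjTwist h]
  rw [hden, hnum, mul_inv_rev, mul_assoc, inv_mul_cancel_left₀ h, regularMobius, classicalMobius]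

theorem regularMobius_zero_left (q : ℍ[ℝ]) : regularMobius 0 q = q := by
  simp [regularMobius, classicalMobius, conjTwist]

end QuaternionBall

theorem QBall.coe_zero : ((0 : QBall) : ℍ[ℝ]) = 0 := rfl

section UnitQuaternions

theorem Sp1.norm_coe (w : Sp1) : ‖(w : ℍ[ℝ])‖ = 1 := mem_sphere_zero_iff_norm.1 w.2

theorem Sp1.star_mul_self (w : Sp1) : star (w : ℍ[ℝ]) * w = 1 := by
  rw [Quaternion.star_mul_self, Quaternion.normSq_eq_norm_mul_self, w.norm_coe, one_mul,
    Quaternion.coe_one]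

theorem Sp1.coe_inv (w : Sp1) : ((w⁻¹ : Sp1) : ℍ[ℝ]) = star (w : ℍ[ℝ]) :=
  (eq_inv_of_mul_eq_one_left w.star_mul_self).symm

theorem Sp1.mul_star_self (w : Sp1) : (w : ℍ[ℝ]) * star (w : ℍ[ℝ]) = 1 := by
  rw [← Sp1.coe_inv]
  exact mul_inv_cancel₀ (ne_zero_of_mem_unit_sphere w)

end UnitQuaternions

section Coordinates

theorem Sp11.norm_apply_one_zero (A : Sp11) : ‖(A : QMat) 1 0‖ = ‖(A : QMat) 0 1‖ := by
  have hcol : Quaternion.normSq ((A : QMat) 0 0) + -Quaternion.normSq ((A : QMat) 1 0) = 1 := by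
    have h := congrFun (congrFun (Sp11.conj_mul_mul A) 0) 0
    simpa [I11, Matrix.mul_apply, Fin.sum_univ_two, Quaternion.star_mul_self] using
      congrArg (fun z : ℍ[ℝ] => z.re) h
  have hrow := (Sp11.normSq_entries A).1
  rw [← mul_self_inj (norm_nonneg _) (norm_nonneg _), ← Quaternion.normSq_eq_norm_mul_self,
    ← Quaternion.normSq_eq_norm_mul_self]
  linarith

theorem Sp11.norm_apply_zero_zero (A : Sp11) : ‖(A : QMat) 0 0‖ = ‖(A : QMat) 1 1‖ := by
  have hrows := Sp11.normSq_entries A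
  simp only [Quaternion.normSq_eq_norm_mul_self, Sp11.norm_apply_one_zero] at hrows
  rw [← mul_self_inj (norm_nonneg _) (norm_nonneg _)]
  linarith

theorem Sp11.apply_one_one_ne_zero (A : Sp11) : (A : QMat) 1 1 ≠ 0 :=
  norm_pos_iff.1 ((norm_nonneg _).trans_lt (Sp11.norm_lt A))

theorem Sp11.coe_inv (A : Sp11) :
    ((A⁻¹ : Sp11) : QMat) = !![star ((A : QMat) 0 0), -star ((A : QMat) 1 0);
      -star ((A : QMat) 0 1), star ((A : QMat) 1 1)] := by
  change I11 * (A : QMat)ᴴ * I11 = _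
  refine Matrix.ext fun i j => ?_
  fin_cases i <;> fin_cases j <;>
    simp [I11, Matrix.mul_apply, Fin.sum_univ_two, Matrix.vecMul, Matrix.vecHead, Matrix.vecTail]

/-- The coordinates `(b d⁻¹, a d⁻¹)` of `A = (a, c; b, d)`: the zero of `𝓕_{A⁻¹}` and its unitary
factor. -/
noncomputable def Sp11.coords (A : Sp11) : QBall × Sp1 :=
  (⟨(A : QMat) 1 0 * ((A : QMat) 1 1)⁻¹, by
      change _ ∈ Metric.ball (0 : ℍ[ℝ]) 1
      rw [mem_ball_zero_iff, norm_mul, norm_inv,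
        mul_inv_lt_iff₀ (norm_pos_iff.2 (Sp11.apply_one_one_ne_zero A)), one_mul,
        Sp11.norm_apply_one_zero A]
      exact Sp11.norm_lt A⟩,
    ⟨(A : QMat) 0 0 * ((A : QMat) 1 1)⁻¹, by
      rw [mem_sphere_zero_iff_norm, norm_mul, norm_inv, Sp11.norm_apply_zero_zero A,
        mul_inv_cancel₀ (norm_ne_zero_iff.2 (Sp11.apply_one_one_ne_zero A))]⟩)

theorem Sp11.apply_one_zero (A : Sp11) :
    (A : QMat) 1 0 = (Sp11.coords A).1 * (A : QMat) 1 1 :=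
  (inv_mul_cancel_right₀ (Sp11.apply_one_one_ne_zero A) _).symm

theorem Sp11.apply_zero_zero (A : Sp11) :
    (A : QMat) 0 0 = (Sp11.coords A).2 * (A : QMat) 1 1 :=
  (inv_mul_cancel_right₀ (Sp11.apply_one_one_ne_zero A) _).symm

theorem Sp11.apply_zero_one (A : Sp11) :
    (A : QMat) 0 1 = (Sp11.coords A).2 * star ((Sp11.coords A).1 : ℍ[ℝ]) * (A : QMat) 1 1 := by
  have hrows : (A : QMat) 0 0 * star ((A : QMat) 1 0) = (A : QMat) 0 1 * star ((A : QMat) 1 1) := by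
    simpa using congrArg star (sub_eq_zero.1 (Sp11.entries A).2.2)
  apply mul_right_cancel₀ (star_ne_zero.2 (Sp11.apply_one_one_ne_zero A))
  rw [← hrows, Sp11.apply_one_zero A, Sp11.apply_zero_zero A, star_mul,
    mul_assoc, ← mul_assoc _ _ (star _), mul_assoc _ _ (star ((A : QMat) 1 1)),
    Quaternion.self_mul_star, mul_assoc, Quaternion.coe_commutes]

end Coordinates

section Boosts

/-- The factor `(1 - |x|²)^{-1/2}` that normalizes the boosts in `Sp(1,1)`. -/
noncomputable def boostScale (x : ℍ[ℝ]) : ℝ := (√(1 - ‖x‖ ^ 2))⁻¹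

variable {x w : ℍ[ℝ]}

theorem boostScale_pos (hx : ‖x‖ < 1) : 0 < boostScale x :=
  inv_pos.2 (Real.sqrt_pos.2 (one_sub_norm_sq_pos hx))

theorem boostScale_sq_mul (hx : ‖x‖ < 1) : boostScale x ^ 2 * (1 - ‖x‖ ^ 2) = 1 := by
  have h := one_sub_norm_sq_pos hx
  rw [boostScale, inv_pow, Real.sq_sqrt h.le, inv_mul_cancel₀ h.ne']

theorem Sp11.boostScale_coords (A : Sp11) : boostScale (Sp11.coords A).1 = ‖(A : QMat) 1 1‖ := by
  have hx := QBall.norm_lt (Sp11.coords A).1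
  have hlower : ‖(A : QMat) 1 1‖ ^ 2 * (1 - ‖((Sp11.coords A).1 : ℍ[ℝ])‖ ^ 2) = 1 := by
    have hrow := (Sp11.normSq_entries A).2
    rw [Sp11.apply_one_zero A, map_mul, Quaternion.normSq_eq_norm_mul_self,
      Quaternion.normSq_eq_norm_mul_self] at hrow
    linarith
  rw [← sq_eq_sq₀ (boostScale_pos hx).le (norm_nonneg _)]
  exact mul_right_cancel₀ (one_sub_norm_sq_pos hx).ne' ((boostScale_sq_mul hx).trans hlower.symm)

/-- The matrix `(1 - |x|²)^{-1/2} (w, w x̄; x, 1)`. -/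
noncomputable def boostMatrix (x w : ℍ[ℝ]) : QMat :=
  boostScale x • !![w, w * star x; x, 1]

theorem boostMatrix_mem (hx : ‖x‖ < 1) (hw : star w * w = 1) : boostMatrix x w ∈ Sp11 := by
  have hform : (!![w, w * star x; x, 1] : QMat)ᴴ * I11 * !![w, w * star x; x, 1]
      = (1 - ‖x‖ ^ 2) • I11 := by
    have hx1 : star x * x = ((‖x‖ ^ 2 : ℝ) : ℍ[ℝ]) := by
      rw [Quaternion.star_mul_self, Quaternion.normSq_eq_norm_mul_self, sq]
    have hx2 : x * star x = ((‖x‖ ^ 2 : ℝ) : ℍ[ℝ]) := by rw [← hx1, star_comm_self']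
    have hw' (z : ℍ[ℝ]) : star w * (w * z) = z := by rw [← mul_assoc, hw, one_mul]
    refine Matrix.ext fun i j => ?_
    fin_cases i <;> fin_cases j <;>
      simp [I11, Matrix.mul_apply, Fin.sum_univ_two, mul_assoc, hw, hx1, hx2, hw', sub_smul,
        ← Quaternion.coe_mul_eq_smul, ← sub_eq_add_neg]
  change (boostMatrix x w)ᴴ * I11 * boostMatrix x w = I11
  rw [boostMatrix, conjTranspose_real_smul, smul_mul_assoc, smul_mul_assoc, mul_smul_comm, hform,
    smul_smul, smul_smul, ← sq, boostScale_sq_mul hx, one_smul]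

end Boosts

/-- The section of `Sp11.coords` given by the matrices `boostMatrix`. -/
noncomputable def boost (t : QBall × Sp1) : Sp11 :=
  ⟨boostMatrix t.1 t.2, boostMatrix_mem (QBall.norm_lt t.1) t.2.star_mul_self⟩

/-- The scalar matrix `v I₂`. -/
noncomputable def scalarSp11 (v : Sp1) : Sp11 := ⟨!![(v : ℍ[ℝ]), 0; 0, (v : ℍ[ℝ])], by
  change _ * I11 * _ = I11
  refine Matrix.ext fun i j => ?_
  fin_cases i <;> fin_cases j <;>
    simp [I11, Matrix.mul_apply, Fin.sum_univ_two, v.star_mul_self]⟩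

theorem mul_scalarSp11_apply (A : Sp11) (v : Sp1) (i j : Fin 2) :
    ((A * scalarSp11 v : Sp11) : QMat) i j = (A : QMat) i j * v := by
  fin_cases j <;> simp [scalarSp11, Matrix.mul_apply, Fin.sum_univ_two]

theorem coords_boost (t : QBall × Sp1) : Sp11.coords (boost t) = t := by
  have hs := (boostScale_pos (QBall.norm_lt t.1)).ne'
  have hcancel (z : ℍ[ℝ]) :
      (boostScale t.1 • z) * (boostScale (t.1 : ℍ[ℝ]) • (1 : ℍ[ℝ]))⁻¹ = z := by
    rw [mul_inv_eq_iff_eq_mul₀ (smul_ne_zero hs one_ne_zero), mul_smul_comm, mul_one]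
  exact Prod.ext (Subtype.ext (hcancel _)) (Subtype.ext (hcancel _))

theorem coords_mul_scalarSp11 (A : Sp11) (v : Sp1) :
    Sp11.coords (A * scalarSp11 v) = Sp11.coords A := by
  have hcancel (z d : ℍ[ℝ]) : z * v * (d * v)⁻¹ = z * d⁻¹ := by
    rw [mul_inv_rev, mul_assoc, mul_inv_cancel_left₀ (ne_zero_of_mem_unit_sphere v)]
  refine Prod.ext (Subtype.ext ?_) (Subtype.ext ?_) <;>
  · simp only [Sp11.coords, mul_scalarSp11_apply]
    exact hcancel _ _

theorem Sp11.exists_eq_boost_mul (A : Sp11) :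
    ∃ v : Sp1, A = boost (Sp11.coords A) * scalarSp11 v := by
  have hdn : ‖(A : QMat) 1 1‖ ≠ 0 := norm_ne_zero_iff.2 (Sp11.apply_one_one_ne_zero A)
  have hcancel (z : ℍ[ℝ]) :
      boostScale (Sp11.coords A).1 • z * (‖(A : QMat) 1 1‖⁻¹ • (A : QMat) 1 1)
        = z * (A : QMat) 1 1 := by
    rw [Sp11.boostScale_coords A, smul_mul_smul_comm, mul_inv_cancel₀ hdn, one_smul]
  refine ⟨⟨‖(A : QMat) 1 1‖⁻¹ • (A : QMat) 1 1, ?_⟩, Subtype.ext (Matrix.ext fun i j => ?_)⟩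
  · rw [mem_sphere_zero_iff_norm, norm_smul, norm_inv, norm_norm, inv_mul_cancel₀ hdn]
  · rw [mul_scalarSp11_apply]
    fin_cases i <;> fin_cases j
    · exact (Sp11.apply_zero_zero A).trans (hcancel _).symm
    · exact (Sp11.apply_zero_one A).trans (hcancel _).symm
    · exact (Sp11.apply_one_zero A).trans (hcancel _).symm
    · exact (one_mul _).symm.trans (hcancel 1).symm

section MobiusMaps

theorem coe_mobiusInvMap (A : Sp11) (q : QBall) :
    (mobiusInvMap A q : ℍ[ℝ]) =
      (((q * -(A : QMat) 1 0 + (A : QMat) 1 1) * star ((A : QMat) 1 1)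
          - q * (q * -(A : QMat) 1 0 + (A : QMat) 1 1) * star ((A : QMat) 1 0))⁻¹
        * (q * (q * -(A : QMat) 1 0 + (A : QMat) 1 1) * star ((A : QMat) 0 0)
          - (q * -(A : QMat) 1 0 + (A : QMat) 1 1) * star ((A : QMat) 0 1))) := by
  change regMobiusFun (A⁻¹ : Sp11) q = _
  rw [regMobiusFun_eq (Sp11.norm_lt _), regSymm_affine_eq, Sp11.coe_inv]
  simp [sub_eq_add_neg, add_comm]

theorem mobiusInvMap_mul_scalarSp11 (A : Sp11) (v : Sp1) :
    mobiusInvMap (A * scalarSp11 v) = mobiusInvMap A := by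
  refine RegMobius.ext fun q => Subtype.ext ?_
  have hden (b d : ℍ[ℝ]) : (q : ℍ[ℝ]) * -(b * v) + d * v = (q * -b + d) * v := by
    rw [add_mul, mul_assoc, neg_mul]
  have hv (z a : ℍ[ℝ]) : z * v * star (a * v) = z * star a := by
    rw [star_mul, mul_assoc, ← mul_assoc (v : ℍ[ℝ]), v.mul_star_self, one_mul]
  simp only [coe_mobiusInvMap, mul_scalarSp11_apply, hden, hv, ← mul_assoc (q : ℍ[ℝ]) _ (v : ℍ[ℝ])]

theorem mobiusInvMap_boost (t : QBall × Sp1) (q : QBall) :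
    (mobiusInvMap (boost t) q : ℍ[ℝ]) = regularMobius t.1 q * star (t.2 : ℍ[ℝ]) := by
  have hs := (boostScale_pos (QBall.norm_lt t.1)).ne'
  have hfactor : (q : ℍ[ℝ]) * -(boostScale t.1 • (t.1 : ℍ[ℝ])) + boostScale t.1 • (1 : ℍ[ℝ])
      = boostScale t.1 • (1 - (q : ℍ[ℝ]) * t.1) := by
    rw [mul_neg, mul_smul_comm, neg_add_eq_sub, smul_sub]
  rw [coe_mobiusInvMap,
    regularMobius_eq (one_sub_mul_ne_zero (QBall.norm_lt q) (QBall.norm_lt t.1))]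
  simp only [boost, boostMatrix, Matrix.smul_apply, Matrix.of_apply, Matrix.cons_val',
    Matrix.cons_val_zero, Matrix.cons_val_one, Matrix.cons_val_fin_one, hfactor,
    Quaternion.star_smul, smul_mul_assoc, mul_smul_comm, star_one, mul_one, ← smul_sub,
    star_mul, star_star, smul_inv₀]
  rw [smul_inv_smul₀ hs, smul_inv_smul₀ hs]
  simp only [sub_mul, mul_assoc]

theorem mobiusInvMap_boost_coords (A : Sp11) :
    mobiusInvMap (boost (Sp11.coords A)) = mobiusInvMap A := by
  obtain ⟨v, hv⟩ := Sp11.exists_eq_boost_mul A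
  conv_rhs => rw [hv, mobiusInvMap_mul_scalarSp11]

theorem mobiusInvMap_surjective : Function.Surjective mobiusInvMap := by
  rintro ⟨F, A, rfl⟩
  exact ⟨A⁻¹, Subtype.ext (congrArg mobius (inv_inv A))⟩

theorem surjective_mobiusInvMap_boost : Function.Surjective fun t => mobiusInvMap (boost t) := by
  intro F
  obtain ⟨A, rfl⟩ := mobiusInvMap_surjective F
  exact ⟨Sp11.coords A, mobiusInvMap_boost_coords A⟩

theorem RegMobius.bijective (F : RegMobius) : Function.Bijective F := by
  obtain ⟨t, rfl⟩ := surjective_mobiusInvMap_boost F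
  have hbij := bijOn_regularMobius (QBall.norm_lt t.1)
  have hw := ne_zero_of_mem_unit_sphere t.2
  constructor
  · intro q q' h
    have h' := congrArg (fun y : QBall => (y : ℍ[ℝ])) h
    simp only [mobiusInvMap_boost] at h'
    exact Subtype.ext (hbij.injOn q.2 q'.2 (mul_right_cancel₀ (star_ne_zero.2 hw) h'))
  · intro y
    obtain ⟨q, hq, hqy⟩ := hbij.surjOn (a := y * t.2) <| mem_ball_zero_iff.2 <| by
      rw [norm_mul, t.2.norm_coe, mul_one]
      exact QBall.norm_lt y
    refine ⟨⟨q, hq⟩, Subtype.ext ?_⟩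
    rw [mobiusInvMap_boost, hqy, mul_assoc, t.2.mul_star_self, mul_one]

theorem inverseOrbit_eq_iff (F : RegMobius) (x : QBall) : inverseOrbit F = x ↔ F x = 0 := by
  constructor
  · rintro rfl
    exact Function.invFun_eq (F.bijective.2 0)
  · intro h
    rw [inverseOrbit, ← h]
    exact Function.leftInverse_invFun F.bijective.1 x

theorem inverseOrbit_mobiusInvMap_boost (t : QBall × Sp1) :
    inverseOrbit (mobiusInvMap (boost t)) = t.1 := by
  refine (inverseOrbit_eq_iff _ _).2 (Subtype.ext ?_)
  rw [mobiusInvMap_boost, regularMobius_self (QBall.norm_lt t.1), zero_mul, QBall.coe_zero]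

theorem injective_mobiusInvMap_boost : Function.Injective fun t => mobiusInvMap (boost t) := by
  rintro ⟨x, w⟩ ⟨x', w'⟩ (h : mobiusInvMap _ = mobiusInvMap _)
  obtain rfl : x = x' := (inverseOrbit_mobiusInvMap_boost (x, w)).symm.trans
    ((congrArg inverseOrbit h).trans (inverseOrbit_mobiusInvMap_boost (x', w')))
  obtain ⟨q, hq, hqy⟩ := (bijOn_regularMobius (QBall.norm_lt x)).surjOn
    (a := ((1 / 2 : ℝ) : ℍ[ℝ])) (mem_ball_zero_iff.2 (by rw [Quaternion.norm_coe]; norm_num))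
  have hval := congrArg (fun F : RegMobius => (F ⟨q, hq⟩ : ℍ[ℝ])) h
  simp only [mobiusInvMap_boost, hqy] at hval
  have hhalf : ((1 / 2 : ℝ) : ℍ[ℝ]) ≠ 0 :=
    norm_ne_zero_iff.1 (by rw [Quaternion.norm_coe]; norm_num)
  rw [Subtype.ext (star_injective (mul_left_cancel₀ hhalf hval))]

/-- The bijection `𝔹 × Sp(1) ≃ 𝓜(𝔹)` that identifies a Möbius transformation with its zero and its
unitary factor. -/
noncomputable def boostEquiv : QBall × Sp1 ≃ RegMobius :=
  Equiv.ofBijective (fun t => mobiusInvMap (boost t))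
    ⟨injective_mobiusInvMap_boost, surjective_mobiusInvMap_boost⟩

theorem boostEquiv_apply (t : QBall × Sp1) (q : QBall) :
    (boostEquiv t q : ℍ[ℝ]) = regularMobius t.1 q * star (t.2 : ℍ[ℝ]) :=
  mobiusInvMap_boost t q

theorem inverseOrbit_boostEquiv (t : QBall × Sp1) : inverseOrbit (boostEquiv t) = t.1 :=
  inverseOrbit_mobiusInvMap_boost t

theorem boostEquiv_coords (A : Sp11) : boostEquiv (Sp11.coords A) = mobiusInvMap A :=
  mobiusInvMap_boost_coords A

theorem boostEquiv_symm_mobiusInvMap (A : Sp11) :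
    boostEquiv.symm (mobiusInvMap A) = Sp11.coords A := by
  rw [Equiv.symm_apply_eq, boostEquiv_coords]

theorem boostEquiv_zero_left (w : Sp1) : boostEquiv (0, w) = (rightMul w⁻¹).1 := by
  refine RegMobius.ext fun q => Subtype.ext ?_
  rw [boostEquiv_apply, rightMul_apply, Sp1.coe_inv, QBall.coe_zero, regularMobius_zero_left]

theorem rightMul_inv_smul_boostEquiv (u w : Sp1) (x : QBall) :
    rightMul u⁻¹ • boostEquiv (x, w) = boostEquiv (x, u * w) := by
  refine RegMobius.ext fun q => Subtype.ext ?_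
  change ((rightMul u⁻¹).1 (boostEquiv (x, w) q) : ℍ[ℝ]) = _
  rw [rightMul_apply, boostEquiv_apply, boostEquiv_apply, Sp1.coe_inv, mul_assoc, ← star_mul,
    Metric.unitSphere.coe_mul]

theorem rightMul_inv_bijective : Function.Bijective fun u : Sp1 => rightMul u⁻¹ := by
  constructor
  · intro u v h
    have hboost : boostEquiv (0, u) = boostEquiv (0, v) := by
      rw [boostEquiv_zero_left, boostEquiv_zero_left]
      exact congrArg Subtype.val h
    exact (Prod.ext_iff.1 (boostEquiv.injective hboost)).2
  · intro F
    obtain ⟨u, rfl⟩ := exists_eq_rightMul F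
    exact ⟨u⁻¹, congrArg rightMul (inv_inv u)⟩

/-- The isomorphism `u ↦ (q ↦ q u⁻¹)` of `Sp(1)` onto `𝓜(𝔹)₀`. -/
noncomputable def isotropyEquiv : Sp1 ≃* RegMobiusZero :=
  MulEquiv.mk (Equiv.ofBijective _ rightMul_inv_bijective) fun u v => Subtype.ext <| by
    change (rightMul (u * v)⁻¹).1 = rightMul u⁻¹ • (rightMul v⁻¹).1
    rw [← boostEquiv_zero_left, ← boostEquiv_zero_left, rightMul_inv_smul_boostEquiv]

theorem isotropyEquiv_apply (u : Sp1) (q : QBall) :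
    ((isotropyEquiv u).1 q : ℍ[ℝ]) = q * ((u⁻¹ : Sp1) : ℍ[ℝ]) :=
  rightMul_apply u⁻¹ q

theorem coe_isotropyEquiv (u : Sp1) : (isotropyEquiv u).1 = boostEquiv (0, u) :=
  (boostEquiv_zero_left u).symm

theorem isotropyEquiv_smul_boostEquiv (u w : Sp1) (x : QBall) :
    isotropyEquiv u • boostEquiv (x, w) = boostEquiv (x, u * w) :=
  rightMul_inv_smul_boostEquiv u w x

end MobiusMaps

section Submersions

open scoped Topology

variable {𝕜 E E' H H' M N : Type*} {n : WithTop ℕ∞} [TopologicalSpace H] [TopologicalSpace H']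
  [TopologicalSpace M] [ChartedSpace H M] [TopologicalSpace N] [ChartedSpace H' N]

theorem mfderiv_surjective_of_section [NontriviallyNormedField 𝕜]
    [NormedAddCommGroup E] [NormedSpace 𝕜 E] [NormedAddCommGroup E'] [NormedSpace 𝕜 E']
    {I : ModelWithCorners 𝕜 E H} {I' : ModelWithCorners 𝕜 E' H'} {f : M → N} {s : N → M} {p : M}
    (hf : MDifferentiableAt I I' f p) (hs : MDifferentiableAt I' I s (f p)) (hp : s (f p) = p)
    (hfs : ∀ᶠ y in 𝓝 (f p), f (s y) = y) : Function.Surjective (mfderiv I I' f p) := by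
  have hcomp : mfderiv I' I' (f ∘ s) (f p) = (mfderiv I I' f p).comp (mfderiv I' I s (f p)) := by
    rw [mfderiv_comp (f p) (hp.symm ▸ hf) hs, hp]
  have hid : mfderiv I' I' (f ∘ s) (f p) = mfderiv I' I' id (f p) :=
    Filter.EventuallyEq.mfderiv_eq hfs
  rw [mfderiv_id] at hid
  exact fun v => ⟨mfderiv I' I s (f p) v, DFunLike.congr_fun (hcomp.symm.trans hid) v⟩

variable [RCLike 𝕜] [NormedAddCommGroup E] [NormedSpace 𝕜 E] [NormedAddCommGroup E']
  [NormedSpace 𝕜 E'] [CompleteSpace E']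

theorem exists_contDiffAt_local_section {g : E → E'} {a : E} (hg : ContDiffAt 𝕜 n g a)
    (hn : n ≠ 0) (hg' : (fderiv 𝕜 g a).HasRightInverse) :
    ∃ s : E' → E, ContDiffAt 𝕜 n s (g a) ∧ s (g a) = a ∧ ∀ᶠ y in 𝓝 (g a), g (s y) = y := by
  obtain ⟨R, hR⟩ := hg'
  let j : E' → E := fun v => a + R (v - g a)
  have hj : ContDiff 𝕜 n j := contDiff_const.add (R.contDiff.comp (contDiff_id.sub contDiff_const))
  have hja : j (g a) = a := by simp [j]
  have hgja : (g ∘ j) (g a) = g a := congrArg g hja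
  have hgj : ContDiffAt 𝕜 n (g ∘ j) (g a) := ContDiffAt.comp _ (hja.symm ▸ hg) hj.contDiffAt
  have hd : HasFDerivAt (g ∘ j) (ContinuousLinearEquiv.refl 𝕜 E' : E' →L[𝕜] E') (g a) := by
    have hdj : HasFDerivAt j R (g a) :=
      (R.hasFDerivAt.comp (g a) ((hasFDerivAt_id (g a)).sub_const (g a))).const_add a
    have hdg : HasFDerivAt g (fderiv 𝕜 g a) (j (g a)) :=
      hja.symm ▸ (hg.differentiableAt hn).hasFDerivAt
    exact (hdg.comp (g a) hdj).congr_fderiv (ContinuousLinearMap.ext hR)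
  have hsmooth := hgj.to_localInverse hd hn
  have hinv := (hgj.hasStrictFDerivAt' hd hn).eventually_right_inverse
  have hga := hgj.localInverse_apply_image hd hn
  rw [hgja] at hsmooth hinv hga
  exact ⟨j ∘ hgj.localInverse hd hn, hj.contDiffAt.comp _ hsmooth, (congrArg j hga).trans hja, hinv⟩

variable {I : ModelWithCorners 𝕜 E H} {I' : ModelWithCorners 𝕜 E' H'}

theorem exists_contMDiffAt_local_section [I.Boundaryless] [IsManifold I n M]
    [IsManifold I' n N] {f : M → N} {p : M} (hf : ContMDiffAt I I' n f p) (hn : n ≠ 0)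
    (hf' : (mfderiv I I' f p).HasRightInverse) :
    ∃ s : N → M, ContMDiffAt I' I n s (f p) ∧ s (f p) = p ∧ ∀ᶠ y in 𝓝 (f p), f (s y) = y := by
  set φ := extChartAt I p
  set ψ := extChartAt I' (f p)
  have hg := (contMDiffAt_iff.1 hf).2
  rw [I.range_eq_univ, contDiffWithinAt_univ] at hg
  have hg' : (fderiv 𝕜 (ψ ∘ f ∘ φ.symm) (φ p)).HasRightInverse := by
    rw [(hf.mdifferentiableAt hn).mfderiv, I.range_eq_univ, fderivWithin_univ] at hf'
    exact hf'
  have hga : (ψ ∘ f ∘ φ.symm) (φ p) = ψ (f p) := by simp [φ]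
  obtain ⟨s, hs, hsa, hgs⟩ := exists_contDiffAt_local_section hg hn hg'
  rw [hga] at hs hsa hgs
  have hψ : ContMDiffAt I' 𝓘(𝕜, E') n ψ (f p) := contMDiffAt_extChartAt
  have hφ : ContMDiffAt 𝓘(𝕜, E) I n φ.symm (s (ψ (f p))) := by
    rw [hsa]
    exact (contMDiffOn_extChartAt_symm (I := I) p).contMDiffAt (extChartAt_target_mem_nhds p)
  have hσ : ContMDiffAt I' I n (φ.symm ∘ s ∘ ψ) (f p) :=
    hφ.comp (f p) (hs.contMDiffAt.comp (f p) hψ)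
  have hσp : (φ.symm ∘ s ∘ ψ) (f p) = p :=
    (congrArg φ.symm hsa).trans (extChartAt_to_inv (I := I) p)
  refine ⟨φ.symm ∘ s ∘ ψ, hσ, hσp, ?_⟩
  have hsource : ∀ᶠ y in 𝓝 (f p), f ((φ.symm ∘ s ∘ ψ) y) ∈ ψ.source := by
    refine (ContinuousAt.comp (g := f) (hσp.symm ▸ hf.continuousAt)
      hσ.continuousAt).eventually_mem ?_
    rw [Function.comp_apply, hσp]
    exact extChartAt_source_mem_nhds (f p)
  filter_upwards [hsource, extChartAt_source_mem_nhds (I := I') (f p),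
    hψ.continuousAt.eventually hgs] with y hfy hy hgy
  exact ψ.injOn hfy hy hgy

end Submersions

theorem contMDiff_of_comp_submersion {E E' E'' H H' H'' M N P : Type*}
    [NormedAddCommGroup E] [NormedSpace ℝ E] [TopologicalSpace H]
    [NormedAddCommGroup E'] [NormedSpace ℝ E'] [FiniteDimensional ℝ E'] [TopologicalSpace H']
    [NormedAddCommGroup E''] [NormedSpace ℝ E''] [TopologicalSpace H'']
    {I : ModelWithCorners ℝ E H} {I' : ModelWithCorners ℝ E' H'} {I'' : ModelWithCorners ℝ E'' H''}
    [I.Boundaryless]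
    [TopologicalSpace M] [ChartedSpace H M] [IsManifold I ∞ M]
    [TopologicalSpace N] [ChartedSpace H' N] [IsManifold I' ∞ N]
    [TopologicalSpace P] [ChartedSpace H'' P]
    {π : M → N} (hπ : IsSurjectiveSubmersion I I' π) {f : N → P}
    (hf : ContMDiff I I'' ∞ (f ∘ π)) : ContMDiff I' I'' ∞ f := by
  have : CompleteSpace E' := FiniteDimensional.complete ℝ E'
  intro b
  obtain ⟨p, rfl⟩ := hπ.surjective b
  let L : E →L[ℝ] E' := mfderiv I I' π p
  obtain ⟨R, hR⟩ := LinearMap.exists_rightInverse_of_surjective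
    (L : E →ₗ[ℝ] E') (LinearMap.range_eq_top.2 (hπ.mfderiv_surjective p))
  have hL : L.HasRightInverse := ⟨LinearMap.toContinuousLinearMap R, LinearMap.congr_fun hR⟩
  obtain ⟨s, hs, hsp, hπs⟩ := exists_contMDiffAt_local_section (hπ.contMDiff p) (by simp) hL
  refine ((hsp.symm ▸ hf p : ContMDiffAt I I'' ∞ (f ∘ π) (s (π p))).comp (π p) hs)
    |>.congr_of_eventuallyEq ?_
  filter_upwards [hπs] with y hy
  exact (congrArg f hy).symm

section Transport

variable {𝕜 E E' H H' M N : Type*} [NontriviallyNormedField 𝕜]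
  [NormedAddCommGroup E] [NormedSpace 𝕜 E] [TopologicalSpace H]
  [NormedAddCommGroup E'] [NormedSpace 𝕜 E'] [TopologicalSpace H']
  {I : ModelWithCorners 𝕜 E H} {I' : ModelWithCorners 𝕜 E' H'} {n : WithTop ℕ∞}
  [TopologicalSpace M] [ChartedSpace H M] [TopologicalSpace N] {h : M ≃ₜ N} {k : H ≃ₜ H'}

/-- The charted space structure on `N` whose charts are those of `M`, carried along a homeomorphism
`h : M ≃ₜ N` and followed by a homeomorphism `k` of the models. -/
abbrev chartedSpaceOfHomeomorph (h : M ≃ₜ N) (k : H ≃ₜ H') : ChartedSpace H' N where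
  atlas := (fun c => h.symm.transOpenPartialHomeomorph (c.transHomeomorph k)) '' atlas H M
  chartAt y := h.symm.transOpenPartialHomeomorph ((chartAt H (h.symm y)).transHomeomorph k)
  mem_chart_source y := mem_chart_source H (h.symm y)
  chart_mem_atlas y := ⟨_, chart_mem_atlas H (h.symm y), rfl⟩

theorem isManifold_chartedSpaceOfHomeomorph [IsManifold I n M] (hk : ContMDiff I I' n k)
    (hk' : ContMDiff I' I n k.symm) :
    letI := chartedSpaceOfHomeomorph h k
    IsManifold I' n N := by
  let _ := chartedSpaceOfHomeomorph h k
  refine isManifold_of_contDiffOn _ _ _ ?_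
  rintro _ _ ⟨c, hc, rfl⟩ ⟨c', hc', rfl⟩
  have htrans : ContMDiffOn I I n (c.symm ≫ₕ c') (c.symm ≫ₕ c').source :=
    contMDiffOn_of_mem_contDiffGroupoid (HasGroupoid.compatible hc hc')
  have htransport : ContMDiffOn I' I' n (k ∘ (c.symm ≫ₕ c') ∘ k.symm)
      (k.symm ⁻¹' (c.symm ≫ₕ c').source) :=
    hk.comp_contMDiffOn (htrans.comp hk'.contMDiffOn fun _ hx => hx)
  have hmodel := I'.contMDiff.comp_contMDiffOn (htransport.comp
    (I'.contMDiffOn_symm.mono Set.inter_subset_right) fun _ hx => hx.1)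
  refine (hmodel.contDiffOn.mono ?_).congr ?_
  · rintro x ⟨hx, hxr⟩
    refine ⟨?_, hxr⟩
    simpa using hx
  · intro x _
    simp

theorem contMDiff_chartedSpaceOfHomeomorph [IsManifold I n M] (hk : ContMDiff I I' n k)
    (hk' : ContMDiff I' I n k.symm) :
    letI := chartedSpaceOfHomeomorph h k
    ContMDiff I I' n h := by
  let _ := chartedSpaceOfHomeomorph h k
  have := isManifold_chartedSpaceOfHomeomorph (h := h) hk hk'
  intro x
  obtain ⟨y, rfl⟩ := h.symm.surjective x
  let c := chartAt H (h.symm y)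
  let e := chartAt H' y
  have hc : ContMDiffOn I I' n (k ∘ c) c.source := hk.comp_contMDiffOn contMDiffOn_chart
  have he : ContMDiffOn I' I' n e.symm e.target := contMDiffOn_chart_symm
  have hmaps : Set.MapsTo (k ∘ c) c.source e.target := fun z hz => by
    change k.symm (k (c z)) ∈ c.target
    rw [k.symm_apply_apply]
    exact c.map_source hz
  refine ((he.comp hc hmaps).congr fun z hz => ?_).contMDiffAt (chart_source_mem_nhds H _)
  change h z = h (c.symm (k.symm (k (c z))))
  rw [k.symm_apply_apply, c.left_inv hz]

theorem contMDiff_symm_chartedSpaceOfHomeomorph [IsManifold I n M] (hk : ContMDiff I I' n k)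
    (hk' : ContMDiff I' I n k.symm) :
    letI := chartedSpaceOfHomeomorph h k
    ContMDiff I' I n h.symm := by
  let _ := chartedSpaceOfHomeomorph h k
  have := isManifold_chartedSpaceOfHomeomorph (h := h) hk hk'
  intro y
  let c := chartAt H (h.symm y)
  let e := chartAt H' y
  have hc : ContMDiffOn I' I n (c.symm ∘ k.symm) (k.symm ⁻¹' c.target) :=
    contMDiffOn_chart_symm.comp hk'.contMDiffOn fun _ hz => hz
  have he : ContMDiffOn I' I' n e e.source := contMDiffOn_chart
  have hmaps : Set.MapsTo e e.source (k.symm ⁻¹' c.target) := fun _ hz => e.map_source hz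
  refine ((hc.comp he hmaps).congr fun z hz => ?_).contMDiffAt (chart_source_mem_nhds H' _)
  change h.symm z = c.symm (k.symm (k (c (h.symm z))))
  rw [k.symm_apply_apply]
  exact (c.left_inv hz).symm

end Transport

theorem isCompact_setOf_smul_inter_nonempty {G X : Type*} [TopologicalSpace G] [CompactSpace G]
    [TopologicalSpace X] [T2Space X] [SMul G X] (hc : Continuous fun x : G × X => x.1 • x.2)
    {K : Set X} (hK : IsCompact K) : IsCompact {g : G | (((g • ·) '' K) ∩ K).Nonempty} := by
  have hcompact : IsCompact ((Set.univ ×ˢ K) ∩ (fun x : G × X => x.1 • x.2) ⁻¹' K) :=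
    (isCompact_univ.prod hK).inter_right (hK.isClosed.preimage hc)
  convert hcompact.image continuous_fst using 1
  ext g
  constructor
  · rintro ⟨_, ⟨x, hx, rfl⟩, hgx⟩
    exact ⟨(g, x), ⟨⟨trivial, hx⟩, hgx⟩, rfl⟩
  · rintro ⟨⟨_, x⟩, ⟨⟨-, hx⟩, hgx⟩, rfl⟩
    exact ⟨_, ⟨x, hx, rfl⟩, hgx⟩

section LieGroups

variable {𝕜 E E' H H' G G' : Type*} [NontriviallyNormedField 𝕜]
  [NormedAddCommGroup E] [NormedSpace 𝕜 E] [TopologicalSpace H] {I : ModelWithCorners 𝕜 E H}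
  [NormedAddCommGroup E'] [NormedSpace 𝕜 E'] [TopologicalSpace H'] {I' : ModelWithCorners 𝕜 E' H'}
  {n : WithTop ℕ∞} [TopologicalSpace G] [ChartedSpace H G] [Group G]
  [TopologicalSpace G'] [ChartedSpace H' G'] [Group G']

theorem lieGroup_of_mulEquiv [LieGroup I n G] [IsManifold I' n G'] {e : G ≃* G'}
    (he : ContMDiff I I' n e) (he' : ContMDiff I' I n e.symm) : LieGroup I' n G' where
  contMDiff_mul := by
    have hmul (p : G' × G') : p.1 * p.2 = e (e.symm p.1 * e.symm p.2) := by simp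
    exact (he.comp ((he'.comp contMDiff_fst).mul (he'.comp contMDiff_snd))).congr hmul
  contMDiff_inv := by
    have hinv (p : G') : p⁻¹ = e (e.symm p)⁻¹ := by simp
    exact (he.comp he'.inv).congr hinv

end LieGroups

section EquivariantBijections

variable {G P B : Type*} [Group G] [MulAction G P] {π : P → B} {φ : B × G ≃ P}

theorem eq_one_of_smul_eq_of_trivialization (hφ : ∀ x g h, φ (x, g * h) = g • φ (x, h))
    {g : G} {p : P} (hgp : g • p = p) : g = 1 := by
  obtain ⟨⟨x, h⟩, rfl⟩ := φ.surjective p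
  rw [← hφ] at hgp
  exact mul_eq_right.1 (Prod.ext_iff.1 (φ.injective hgp)).2

theorem eq_iff_exists_smul_eq_of_trivialization (hπ : ∀ x g, π (φ (x, g)) = x)
    (hφ : ∀ x g h, φ (x, g * h) = g • φ (x, h)) {p p' : P} :
    π p = π p' ↔ ∃ g : G, g • p = p' := by
  obtain ⟨⟨x, h⟩, rfl⟩ := φ.surjective p
  obtain ⟨⟨x', h'⟩, rfl⟩ := φ.surjective p'
  rw [hπ, hπ]
  constructor
  · rintro rfl
    exact ⟨h' * h⁻¹, by rw [← hφ, inv_mul_cancel_right]⟩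
  · rintro ⟨g, hg⟩
    rw [← hφ] at hg
    exact (Prod.ext_iff.1 (φ.injective hg)).1

end EquivariantBijections

section Trivializations

variable {EG HG EP HP EB HB G P B : Type*}
  [NormedAddCommGroup EG] [NormedSpace ℝ EG] [TopologicalSpace HG]
  [NormedAddCommGroup EP] [NormedSpace ℝ EP] [TopologicalSpace HP]
  [NormedAddCommGroup EB] [NormedSpace ℝ EB] [TopologicalSpace HB]
  {IG : ModelWithCorners ℝ EG HG} {IP : ModelWithCorners ℝ EP HP} {IB : ModelWithCorners ℝ EB HB}
  [TopologicalSpace G] [ChartedSpace HG G] [TopologicalSpace P] [ChartedSpace HP P]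
  [TopologicalSpace B] [ChartedSpace HB B] {π : P → B}
  {φ : Diffeomorph (IB.prod IG) IP (B × G) P ∞}

theorem isSurjectiveSubmersion_of_trivialization [Nonempty G] (hπ : ∀ x g, π (φ (x, g)) = x) :
    IsSurjectiveSubmersion IP IB π := by
  have hsmooth : ContMDiff IP IB ∞ π := by
    refine (contMDiff_fst.comp φ.symm.contMDiff).congr fun p => ?_
    obtain ⟨⟨x, g⟩, rfl⟩ := EquivLike.surjective φ p
    rw [hπ, Function.comp_apply, φ.symm_apply_apply]
  refine ⟨hsmooth, fun x => ⟨φ (x, Classical.arbitrary G), hπ x _⟩, fun p => ?_⟩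
  obtain ⟨⟨x, g⟩, rfl⟩ := EquivLike.surjective φ p
  have hsection : ContMDiff IB IP ∞ fun y => φ (y, g) :=
    φ.contMDiff.comp (contMDiff_id.prodMk contMDiff_const)
  exact mfderiv_surjective_of_section (hsmooth.mdifferentiable (by simp) _)
    (hsection.mdifferentiable (by simp) _) (by rw [hπ]) (.of_forall fun y => hπ y g)

variable [Group G] [MulAction G P]

theorem contMDiff_smul_of_trivialization [ContMDiffMul IG ∞ G]
    (hφ : ∀ x g h, φ (x, g * h) = g • φ (x, h)) :
    ContMDiff (IG.prod IP) IP ∞ fun x : G × P => x.1 • x.2 := by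
  have hcoord := φ.symm.contMDiff.comp (contMDiff_snd (I := IG) (M := G))
  refine (φ.contMDiff.comp ((contMDiff_fst.comp hcoord).prodMk
    (contMDiff_fst.mul (contMDiff_snd.comp hcoord)))).congr ?_
  rintro ⟨g, p⟩
  obtain ⟨⟨x, h⟩, rfl⟩ := EquivLike.surjective φ p
  simp [hφ]

theorem IsGloballyTrivial.isLeftPrincipalBundle [IsManifold IP ∞ P] [IsManifold IB ∞ B]
    [LieGroup IG ∞ G] [CompactSpace G] [T2Space P] (h : IsGloballyTrivial IG IP IB G π) :
    IsLeftPrincipalBundle IG IP IB G π := by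
  obtain ⟨φ, hπ, hφ⟩ := h
  have hsmul := contMDiff_smul_of_trivialization hφ
  exact
    { manifold_total := inferInstance
      manifold_base := inferInstance
      lieGroup := inferInstance
      submersion := isSurjectiveSubmersion_of_trivialization hπ
      smooth_action := hsmul
      free := fun _ _ => eq_one_of_smul_eq_of_trivialization (φ := φ.toEquiv) hφ
      proper := fun _ => isCompact_setOf_smul_inter_nonempty hsmul.continuous
      fibers := fun _ _ =>
        eq_iff_exists_smul_eq_of_trivialization (φ := φ.toEquiv) hπ hφ
      locally_trivial := fun _ => ⟨Set.univ, isOpen_univ, trivial,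
        φ.toHomeomorph.toOpenPartialHomeomorph, by simp, by simp, φ.contMDiff.contMDiffOn,
        φ.symm.contMDiff.contMDiffOn, fun x _ => hπ x, fun x _ => hφ x⟩ }

end Trivializations

section Slices

theorem mem_maximalAtlas_of_diffeomorph {𝕜 E E' H H' M N : Type*} [NontriviallyNormedField 𝕜]
    [NormedAddCommGroup E] [NormedSpace 𝕜 E] [TopologicalSpace H]
    [NormedAddCommGroup E'] [NormedSpace 𝕜 E'] [TopologicalSpace H']
    {I : ModelWithCorners 𝕜 E H} {I' : ModelWithCorners 𝕜 E' H'} {n : WithTop ℕ∞}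
    [TopologicalSpace M] [ChartedSpace H M] [IsManifold I n M]
    [TopologicalSpace N] [ChartedSpace H' N] [IsManifold I' n N]
    {Φ : Diffeomorph I I' M N n} {k : H ≃ₜ H'} (hk : ContMDiff I I' n k)
    (hk' : ContMDiff I' I n k.symm) {c : OpenPartialHomeomorph M H}
    (hc : c ∈ IsManifold.maximalAtlas I n M) :
    Φ.symm.toHomeomorph.transOpenPartialHomeomorph (c.transHomeomorph k) ∈
      IsManifold.maximalAtlas I' n N := by
  refine OpenPartialHomeomorph.mem_maximalAtlas_of_contMDiffOn _ ?_ ?_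
  · exact hk.comp_contMDiffOn ((contMDiffOn_of_mem_maximalAtlas hc).comp
      Φ.symm.contMDiff.contMDiffOn fun _ hx => hx)
  · exact Φ.contMDiff.comp_contMDiffOn ((contMDiffOn_symm_of_mem_maximalAtlas hc).comp
      hk'.contMDiffOn fun _ hx => hx)

variable {𝕜 EB EG EP B G P : Type*} [NontriviallyNormedField 𝕜]
  [NormedAddCommGroup EB] [NormedSpace 𝕜 EB] [NormedAddCommGroup EG] [NormedSpace 𝕜 EG]
  [NormedAddCommGroup EP] [NormedSpace 𝕜 EP] {n : WithTop ℕ∞}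

/-- The identification `(y, v) ↦ L (v, y - y₀)` of model spaces: it straightens the slice `y = y₀`
to the form `v ↦ L (v, 0)` in which immersions are normalized. -/
def sliceHomeomorph (L : (EG × EB) ≃L[𝕜] EP) (y₀ : EB) : ModelProd EB EG ≃ₜ EP :=
  (((Homeomorph.subRight y₀).prodCongr (Homeomorph.refl EG)).trans
    (Homeomorph.prodComm EB EG)).trans L.toHomeomorph

theorem contMDiff_modelProd_of_contDiff {f : EB × EG → EP} (hf : ContDiff 𝕜 n f) :
    ContMDiff (M := ModelProd EB EG) (𝓘(𝕜, EB).prod 𝓘(𝕜, EG)) 𝓘(𝕜, EP) n f := by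
  rw [← modelWithCornersSelf_prod]
  exact hf.contMDiff

theorem contMDiff_to_modelProd_of_contDiff {f : EP → EB × EG} (hf : ContDiff 𝕜 n f) :
    ContMDiff (M' := ModelProd EB EG) 𝓘(𝕜, EP) (𝓘(𝕜, EB).prod 𝓘(𝕜, EG)) n f := by
  rw [← modelWithCornersSelf_prod]
  exact hf.contMDiff

theorem contMDiff_sliceHomeomorph (L : (EG × EB) ≃L[𝕜] EP) (y₀ : EB) :
    ContMDiff (𝓘(𝕜, EB).prod 𝓘(𝕜, EG)) 𝓘(𝕜, EP) n (sliceHomeomorph L y₀) :=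
  contMDiff_modelProd_of_contDiff
    (L.contDiff.comp (contDiff_snd.prodMk (contDiff_fst.sub contDiff_const)))

theorem contMDiff_sliceHomeomorph_symm (L : (EG × EB) ≃L[𝕜] EP) (y₀ : EB) :
    ContMDiff 𝓘(𝕜, EP) (𝓘(𝕜, EB).prod 𝓘(𝕜, EG)) n (sliceHomeomorph L y₀).symm :=
  contMDiff_to_modelProd_of_contDiff
    (((contDiff_snd.comp L.symm.contDiff).add contDiff_const).prodMk
      (contDiff_fst.comp L.symm.contDiff))

variable [TopologicalSpace B] [ChartedSpace EB B] [IsManifold 𝓘(𝕜, EB) n B]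
  [TopologicalSpace G] [ChartedSpace EG G] [IsManifold 𝓘(𝕜, EG) n G]
  [TopologicalSpace P] [ChartedSpace EP P] [IsManifold 𝓘(𝕜, EP) n P]

theorem isImmersion_slice (L : (EG × EB) ≃L[𝕜] EP)
    (Φ : Diffeomorph (𝓘(𝕜, EB).prod 𝓘(𝕜, EG)) 𝓘(𝕜, EP) (B × G) P n) (b : B) :
    Manifold.IsImmersion 𝓘(𝕜, EG) 𝓘(𝕜, EP) n fun g => Φ (b, g) := by
  refine Manifold.IsImmersionOfComplement.isImmersion (F := EB) fun g => ?_
  let c := chartAt EG g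
  let p := chartAt (ModelProd EB EG) (b, g)
  let k := sliceHomeomorph L (chartAt EB b b)
  let cod := Φ.symm.toHomeomorph.transOpenPartialHomeomorph (p.transHomeomorph k)
  have hcod : cod ∈ IsManifold.maximalAtlas 𝓘(𝕜, EP) n P :=
    mem_maximalAtlas_of_diffeomorph (contMDiff_sliceHomeomorph L _)
      (contMDiff_sliceHomeomorph_symm L _) (IsManifold.chart_mem_maximalAtlas _)
  have hsource : c.source ⊆ (fun g => Φ (b, g)) ⁻¹' cod.source := by
    intro g' hg'
    change Φ.symm (Φ (b, g')) ∈ p.source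
    rw [Φ.symm_apply_apply]
    exact ⟨mem_chart_source EB b, hg'⟩
  refine .mk_of_charts L c cod (mem_chart_source EG g) (hsource (mem_chart_source EG g))
    (IsManifold.chart_mem_maximalAtlas g) hcod hsource fun v hv => ?_
  have hv' : v ∈ c.target := by simpa using hv
  change k (p (Φ.symm (Φ (b, c.symm v)))) = L (v, 0)
  rw [Φ.symm_apply_apply]
  change L (c (c.symm v), chartAt EB b b - chartAt EB b b) = L (v, 0)
  rw [c.right_inv hv', sub_self]

end Slices

section Sp11Charts

theorem Sp11.mem_source_chart {g A : Sp11} :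
    A ∈ (Sp11.chart g).source ↔ IsUnit (1 + ((g⁻¹ * A : Sp11) : QMat)) := by
  simp only [Sp11.chart, Sp11.chartOne, OpenPartialHomeomorph.trans_source]
  exact ⟨fun h => h.2, fun h => ⟨trivial, h⟩⟩

theorem Sp11.isUnit_one_add_inv_mul_self (g : Sp11) :
    IsUnit (1 + ((g⁻¹ * g : Sp11) : QMat)) :=
  Sp11.mem_source_chart.1 (mem_chart_source sp11 g)

theorem Sp11.coe_chart {g A : Sp11} (hA : IsUnit (1 + ((g⁻¹ * A : Sp11) : QMat))) :
    ((Sp11.chart g A : sp11) : QMat) = cayley ((g⁻¹ * A : Sp11) : QMat) :=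
  sp11Proj_coe _ (cayley_mem_sp11 (g⁻¹ * A).2 hA)

theorem Sp11.coe_mul_cayley_chart {g A : Sp11}
    (hA : IsUnit (1 + ((g⁻¹ * A : Sp11) : QMat))) :
    (g : QMat) * cayley ((Sp11.chart g A : sp11) : QMat) = A := by
  rw [Sp11.coe_chart hA, cayley_cayley hA]
  change ((g * (g⁻¹ * A) : Sp11) : QMat) = A
  rw [mul_inv_cancel_left]

theorem contMDiff_coe_Sp11 :
    ContMDiff 𝓘(ℝ, sp11) 𝓘(ℝ, QMat) ∞ (Subtype.val : Sp11 → QMat) := by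
  intro g
  have hchart : ContMDiffAt 𝓘(ℝ, sp11) 𝓘(ℝ, sp11) ∞ (Sp11.chart g) g :=
    contMDiffOn_chart.contMDiffAt (chart_source_mem_nhds sp11 g)
  have hunit : IsUnit (1 + ((Sp11.chart g g : sp11) : QMat)) := by
    have hg := Sp11.isUnit_one_add_inv_mul_self g
    rw [Sp11.coe_chart hg]
    exact isUnit_cayley_add_one hg
  have hcayley :
      ContDiffAt ℝ ∞ (fun X : sp11 => (g : QMat) * cayley (X : QMat)) (Sp11.chart g g) :=
    contDiffAt_const.mul <| ContDiffAt.comp (g := cayley) _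
      (contDiffOn_cayley.contDiffAt (isOpen_isUnit_one_add.mem_nhds hunit))
      sp11.subtypeL.contDiff.contDiffAt
  refine (hcayley.contMDiffAt.comp g hchart).congr_of_eventuallyEq ?_
  filter_upwards [chart_source_mem_nhds sp11 g] with A hA
  exact (Sp11.coe_mul_cayley_chart (Sp11.mem_source_chart.1 hA)).symm

theorem contMDiff_Sp11_of_coe {E H M : Type*} [NormedAddCommGroup E] [NormedSpace ℝ E]
    [TopologicalSpace H] {I : ModelWithCorners ℝ E H} [TopologicalSpace M] [ChartedSpace H M]
    {f : M → Sp11} (hf : ContMDiff I 𝓘(ℝ, QMat) ∞ fun x => (f x : QMat)) :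
    ContMDiff I 𝓘(ℝ, sp11) ∞ f := by
  intro x
  refine contMDiffAt_iff_target.2
    ⟨(continuous_induced_rng.2 hf.continuous).continuousAt, ?_⟩
  have hchart :
      ContDiffAt ℝ ∞ (fun X : QMat => sp11Proj (cayley (((f x)⁻¹ : Sp11) * X))) (f x) :=
    sp11Proj.contDiff.contDiffAt.comp _ <| ContDiffAt.comp (g := cayley) _
      (contDiffOn_cayley.contDiffAt
        (isOpen_isUnit_one_add.mem_nhds (Sp11.isUnit_one_add_inv_mul_self (f x))))
      (contDiffAt_const.mul contDiffAt_id)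
  exact ContMDiffAt.comp (f := fun y => (f y : QMat)) x hchart.contMDiffAt (hf x)

end Sp11Charts

section Smoothness

theorem contDiff_matrix_entry (i j : Fin 2) : ContDiff ℝ ∞ fun X : QMat => X i j :=
  (LinearMap.toContinuousLinearMap (Matrix.entryLinearMap ℝ ℍ[ℝ] i j)).contDiff

theorem contDiff_matrix_of {E : Type*} [NormedAddCommGroup E] [NormedSpace ℝ E]
    {f : E → Fin 2 → Fin 2 → ℍ[ℝ]} (hf : ∀ i j, ContDiff ℝ ∞ fun x => f x i j) :
    ContDiff ℝ ∞ fun x => (Matrix.of (f x) : QMat) :=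
  (LinearMap.toContinuousLinearMap
    (Matrix.ofLinearEquiv ℝ : (Fin 2 → Fin 2 → ℍ[ℝ]) ≃ₗ[ℝ] QMat).toLinearMap).contDiff.comp
    (contDiff_pi.2 fun i => contDiff_pi.2 fun j => hf i j)

theorem contDiff_quaternion_star : ContDiff ℝ ∞ (star : ℍ[ℝ] → ℍ[ℝ]) := by
  have : StarModule ℝ ℍ[ℝ] := ⟨fun r q => Quaternion.star_smul r q⟩
  exact (starL' ℝ : ℍ[ℝ] ≃L[ℝ] ℍ[ℝ]).contDiff

theorem contDiffAt_quaternion_inv {d : ℍ[ℝ]} (hd : d ≠ 0) :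
    ContDiffAt ℝ ∞ (fun q : ℍ[ℝ] => q⁻¹) d := by
  simpa only [Ring.inverse_eq_inv'] using! contDiffAt_ringInverse ℝ (Units.mk0 d hd)

theorem contMDiff_Sp11_entry_mul_inv (i j : Fin 2) :
    ContMDiff 𝓘(ℝ, sp11) 𝓘(ℝ, ℍ[ℝ]) ∞
      fun A : Sp11 => (A : QMat) i j * ((A : QMat) 1 1)⁻¹ := by
  intro A
  have hquot : ContDiffAt ℝ ∞ (fun X : QMat => X i j * (X 1 1)⁻¹) A :=
    (contDiff_matrix_entry i j).contDiffAt.mul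
      ((contDiffAt_quaternion_inv (Sp11.apply_one_one_ne_zero A)).comp (A : QMat)
        (contDiff_matrix_entry 1 1).contDiffAt)
  exact hquot.contMDiffAt.comp A (contMDiff_coe_Sp11 A)

theorem contMDiff_coords :
    ContMDiff 𝓘(ℝ, sp11) (𝓘(ℝ, ℍ[ℝ]).prod (𝓡 3)) ∞ Sp11.coords := by
  refine ContMDiff.prodMk (f := fun A => (Sp11.coords A).1) (g := fun A => (Sp11.coords A).2)
    ?_ ?_
  · rw [← ContMDiff.subtypeVal_comp_iff]
    exact contMDiff_Sp11_entry_mul_inv 1 0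
  · exact (contMDiff_Sp11_entry_mul_inv 0 0).codRestrict_sphere fun A => (Sp11.coords A).2.2

theorem contDiffAt_boostMatrix {x w : ℍ[ℝ]} (hx : ‖x‖ < 1) :
    ContDiffAt ℝ ∞ (fun y : ℍ[ℝ] × ℍ[ℝ] => boostMatrix y.1 y.2) (x, w) := by
  have hpos := one_sub_norm_sq_pos hx
  have hscale : ContDiffAt ℝ ∞ (fun y : ℍ[ℝ] × ℍ[ℝ] => boostScale y.1) (x, w) :=
    ((contDiffAt_const.sub (contDiff_fst.norm_sq ℝ).contDiffAt).sqrt hpos.ne').inv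
      (Real.sqrt_pos.2 hpos).ne'
  refine hscale.smul (contDiff_matrix_of fun i j => ?_).contDiffAt
  fin_cases i <;> fin_cases j
  · exact contDiff_snd
  · exact contDiff_snd.mul (contDiff_quaternion_star.comp contDiff_fst)
  · exact contDiff_fst
  · exact contDiff_const

theorem contMDiff_boost :
    ContMDiff (𝓘(ℝ, ℍ[ℝ]).prod (𝓡 3)) 𝓘(ℝ, sp11) ∞ boost := by
  refine contMDiff_Sp11_of_coe fun t => ?_
  have hcoe : ContMDiff (𝓘(ℝ, ℍ[ℝ]).prod (𝓡 3)) 𝓘(ℝ, ℍ[ℝ] × ℍ[ℝ]) ∞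
      fun t : QBall × Sp1 => ((t.1 : ℍ[ℝ]), (t.2 : ℍ[ℝ])) :=
    (contMDiff_subtype_val.comp contMDiff_fst).prodMk_space
      (contMDiff_coe_sphere.comp contMDiff_snd)
  exact ContMDiffAt.comp (f := fun t : QBall × Sp1 => ((t.1 : ℍ[ℝ]), (t.2 : ℍ[ℝ]))) t
    (contDiffAt_boostMatrix (QBall.norm_lt t.1)).contMDiffAt (hcoe t)

theorem contMDiff_mul_right_Sp11 (B : Sp11) :
    ContMDiff 𝓘(ℝ, sp11) 𝓘(ℝ, sp11) ∞ fun A : Sp11 => A * B :=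
  contMDiff_Sp11_of_coe <|
    ((contDiff_id.mul contDiff_const).contMDiff (f := fun X : QMat => X * (B : QMat))).comp
      contMDiff_coe_Sp11

instance : LieGroup (𝓡 3) ∞ Sp1 where
  contMDiff_mul := by
    have hcoe : ContMDiff ((𝓡 3).prod (𝓡 3)) 𝓘(ℝ, ℍ[ℝ] × ℍ[ℝ]) ∞
        fun p : Sp1 × Sp1 => ((p.1 : ℍ[ℝ]), (p.2 : ℍ[ℝ])) :=
      (contMDiff_coe_sphere.comp contMDiff_fst).prodMk_space
        (contMDiff_coe_sphere.comp contMDiff_snd)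
    have hmul : ContMDiff ((𝓡 3).prod (𝓡 3)) 𝓘(ℝ, ℍ[ℝ]) ∞
        fun p : Sp1 × Sp1 => (p.1 : ℍ[ℝ]) * (p.2 : ℍ[ℝ]) :=
      (contDiff_fst.mul contDiff_snd).contMDiff.comp hcoe
    exact hmul.codRestrict_sphere fun p => (p.1 * p.2).2
  contMDiff_inv := by
    have hinv : ContMDiff (𝓡 3) 𝓘(ℝ, ℍ[ℝ]) ∞ fun u : Sp1 => ((u⁻¹ : Sp1) : ℍ[ℝ]) := by
      simp only [Sp1.coe_inv]
      exact contDiff_quaternion_star.contMDiff.comp contMDiff_coe_sphere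
    exact hinv.codRestrict_sphere fun u => (u⁻¹).2

end Smoothness

section QuotientManifold

/-- A linear identification of the model space of `Sp(1) × 𝔹` with `ℝ⁷`. -/
noncomputable def modelEquiv :
    (EuclideanSpace ℝ (Fin 3) × ℍ[ℝ]) ≃L[ℝ] EuclideanSpace ℝ (Fin 7) :=
  ContinuousLinearEquiv.ofFinrankEq <| by
    simp only [Module.finrank_prod, Quaternion.finrank_eq_four, finrank_euclideanSpace_fin]

theorem exists_isQuotientManifold :
    ∃ (_ : TopologicalSpace RegMobius) (_ : ChartedSpace (EuclideanSpace ℝ (Fin 7)) RegMobius),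
      IsQuotientManifold := by
  let _ : TopologicalSpace RegMobius := TopologicalSpace.induced boostEquiv.symm inferInstance
  let e : QBall × Sp1 ≃ₜ RegMobius := (boostEquiv.symm.toHomeomorphOfIsInducing ⟨rfl⟩).symm
  let k := sliceHomeomorph modelEquiv (0 : ℍ[ℝ])
  have hk : ContMDiff (𝓘(ℝ, ℍ[ℝ]).prod (𝓡 3)) (𝓡 7) ∞ k := contMDiff_sliceHomeomorph _ _
  have hk' : ContMDiff (𝓡 7) (𝓘(ℝ, ℍ[ℝ]).prod (𝓡 3)) ∞ k.symm :=
    contMDiff_sliceHomeomorph_symm _ _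
  let _ := chartedSpaceOfHomeomorph e k
  have hmanifold := isManifold_chartedSpaceOfHomeomorph (h := e) hk hk'
  have hcoords : mobiusInvMap = e ∘ Sp11.coords := funext fun A => (boostEquiv_coords A).symm
  have hsmooth : ContMDiff 𝓘(ℝ, sp11) (𝓡 7) ∞ mobiusInvMap :=
    hcoords ▸ (contMDiff_chartedSpaceOfHomeomorph hk hk').comp contMDiff_coords
  refine ⟨_, _, hmanifold, e.t2Space, e.symm.secondCountableTopology, hsmooth,
    mobiusInvMap_surjective, fun A => ?_⟩
  obtain ⟨v, hv⟩ := Sp11.exists_eq_boost_mul A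
  have hsection : ContMDiff (𝓡 7) 𝓘(ℝ, sp11) ∞ fun F => boost (e.symm F) * scalarSp11 v :=
    (contMDiff_mul_right_Sp11 _).comp
      (contMDiff_boost.comp (contMDiff_symm_chartedSpaceOfHomeomorph hk hk'))
  refine mfderiv_surjective_of_section
    (hsmooth.mdifferentiableAt (by simp)) (hsection.mdifferentiableAt (by simp)) ?_
    (.of_forall fun F => ?_)
  · rw [hcoords, Function.comp_apply, e.symm_apply_apply, ← hv]
  · rw [hcoords, Function.comp_apply, coords_mul_scalarSp11, coords_boost, e.apply_symm_apply]

variable [TopologicalSpace RegMobius] [ChartedSpace (EuclideanSpace ℝ (Fin 7)) RegMobius]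

/-- The global trivialization `𝔹 × Sp(1) → 𝓜(𝔹)`, for any quotient manifold structure. -/
noncomputable def boostDiffeomorph (h : IsQuotientManifold) :
    Diffeomorph (𝓘(ℝ, ℍ[ℝ]).prod (𝓡 3)) (𝓡 7) (QBall × Sp1) RegMobius ∞ where
  toEquiv := boostEquiv
  contMDiff_toFun := h.submersion.contMDiff.comp contMDiff_boost
  contMDiff_invFun := by
    have := h.manifold
    refine contMDiff_of_comp_submersion h.submersion ?_
    have hcoords : boostEquiv.symm ∘ mobiusInvMap = Sp11.coords :=
      funext boostEquiv_symm_mobiusInvMap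
    rw [hcoords]
    exact contMDiff_coords

/-- The isomorphism `isotropyEquiv` is a homeomorphism for the subspace topology of `𝓜(𝔹)₀`. -/
noncomputable def isotropyHomeomorph (h : IsQuotientManifold) : Sp1 ≃ₜ RegMobiusZero where
  toEquiv := isotropyEquiv.toEquiv
  continuous_toFun :=
    have hslice : Continuous fun u => boostDiffeomorph h ((0 : QBall), u) :=
      (boostDiffeomorph h).continuous.comp (by fun_prop)
    continuous_induced_rng.2 (hslice.congr fun u => (coe_isotropyEquiv u).symm)
  continuous_invFun := by
    have hsnd : Continuous fun F : RegMobiusZero => ((boostDiffeomorph h).symm F.1).2 :=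
      continuous_snd.comp
        ((boostDiffeomorph h).symm.continuous.comp continuous_subtype_val)
    refine hsnd.congr fun F => ?_
    obtain ⟨u, rfl⟩ := isotropyEquiv.surjective F
    rw [coe_isotropyEquiv]
    exact (congrArg Prod.snd (boostEquiv.symm_apply_apply (0, u))).trans
      (isotropyEquiv.symm_apply_apply u).symm

variable [ChartedSpace (EuclideanSpace ℝ (Fin 3)) RegMobiusZero]

/-- The global trivialization of the inverse orbit map, for charts on `𝓜(𝔹)₀` that make
`isotropyEquiv` a diffeomorphism. -/
noncomputable def orbitTrivialization (h : IsQuotientManifold)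
    (hρ : ContMDiff (𝓡 3) (𝓡 3) ∞ isotropyEquiv)
    (hρ' : ContMDiff (𝓡 3) (𝓡 3) ∞ isotropyEquiv.symm) :
    Diffeomorph (𝓘(ℝ, ℍ[ℝ]).prod (𝓡 3)) (𝓡 7) (QBall × RegMobiusZero) RegMobius ∞ :=
  ((Diffeomorph.refl 𝓘(ℝ, ℍ[ℝ]) QBall ∞).prodCongr
    ⟨isotropyEquiv.symm.toEquiv, hρ', hρ⟩).trans (boostDiffeomorph h)

variable (h : IsQuotientManifold) (hρ : ContMDiff (𝓡 3) (𝓡 3) ∞ isotropyEquiv)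
  (hρ' : ContMDiff (𝓡 3) (𝓡 3) ∞ isotropyEquiv.symm)

theorem orbitTrivialization_apply (x : QBall) (F : RegMobiusZero) :
    orbitTrivialization h hρ hρ' (x, F) = boostEquiv (x, isotropyEquiv.symm F) := rfl

theorem orbitTrivialization_mul (x : QBall) (F G : RegMobiusZero) :
    orbitTrivialization h hρ hρ' (x, F * G) = F • orbitTrivialization h hρ hρ' (x, G) := by
  rw [orbitTrivialization_apply, orbitTrivialization_apply, map_mul,
    ← isotropyEquiv_smul_boostEquiv, isotropyEquiv.apply_symm_apply]

include h hρ hρ'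

theorem isGloballyTrivial_inverseOrbit :
    IsGloballyTrivial (𝓡 3) (𝓡 7) 𝓘(ℝ, ℍ[ℝ]) RegMobiusZero inverseOrbit :=
  ⟨orbitTrivialization h hρ hρ', fun _ _ => inverseOrbit_boostEquiv _,
    orbitTrivialization_mul h hρ hρ'⟩

theorem isSmoothEmbedding_coe_regMobiusZero [IsManifold (𝓡 3) ∞ RegMobiusZero] :
    Manifold.IsSmoothEmbedding (𝓡 3) (𝓡 7) ∞ (Subtype.val : RegMobiusZero → RegMobius) := by
  have := h.manifold
  have hslice : Subtype.val = fun F : RegMobiusZero => orbitTrivialization h hρ hρ' (0, F) := by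
    funext F
    rw [orbitTrivialization_apply, ← coe_isotropyEquiv, isotropyEquiv.apply_symm_apply]
  refine ⟨?_, Topology.IsEmbedding.subtypeVal⟩
  rw [hslice]
  exact isImmersion_slice modelEquiv (orbitTrivialization h hρ hρ') 0

end QuotientManifold

theorem mainTheorem7 :
    (∀ F : RegMobius, Function.Bijective F) ∧
    (∃ (_ : TopologicalSpace RegMobius) (_ : ChartedSpace (EuclideanSpace ℝ (Fin 7)) RegMobius),
      IsQuotientManifold) ∧
    ∀ [TopologicalSpace RegMobius] [ChartedSpace (EuclideanSpace ℝ (Fin 7)) RegMobius],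
      IsQuotientManifold →
      ∃ _ : ChartedSpace (EuclideanSpace ℝ (Fin 3)) RegMobiusZero,
        Manifold.IsSmoothEmbedding (𝓡 3) (𝓡 7) ∞ (Subtype.val : RegMobiusZero → RegMobius) ∧
        (∃ ρ : Sp1 ≃* RegMobiusZero,
          (∀ (u : Sp1) (q : QBall), ((ρ u).1 q : ℍ[ℝ]) = q * ((u⁻¹ : Sp1) : ℍ[ℝ])) ∧
          ContMDiff (𝓡 3) (𝓡 3) ∞ ρ ∧ ContMDiff (𝓡 3) (𝓡 3) ∞ ρ.symm) ∧
        IsLeftPrincipalBundle (𝓡 3) (𝓡 7) 𝓘(ℝ, ℍ[ℝ]) RegMobiusZero inverseOrbit ∧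
        IsGloballyTrivial (𝓡 3) (𝓡 7) 𝓘(ℝ, ℍ[ℝ]) RegMobiusZero inverseOrbit := by
  refine ⟨RegMobius.bijective, exists_isQuotientManifold, ?_⟩
  intro _ _ h
  have hid := contMDiff_id (I := 𝓡 3) (M := EuclideanSpace ℝ (Fin 3)) (n := ∞)
  let k := Homeomorph.refl (EuclideanSpace ℝ (Fin 3))
  let charts := chartedSpaceOfHomeomorph (isotropyHomeomorph h) k
  have : IsManifold (𝓡 3) ∞ RegMobiusZero := isManifold_chartedSpaceOfHomeomorph hid hid
  have hρ : ContMDiff (𝓡 3) (𝓡 3) ∞ isotropyEquiv :=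
    contMDiff_chartedSpaceOfHomeomorph (h := isotropyHomeomorph h) (k := k) hid hid
  have hρ' : ContMDiff (𝓡 3) (𝓡 3) ∞ isotropyEquiv.symm :=
    contMDiff_symm_chartedSpaceOfHomeomorph (h := isotropyHomeomorph h) (k := k) hid hid
  have : LieGroup (𝓡 3) ∞ RegMobiusZero := lieGroup_of_mulEquiv hρ hρ'
  have : CompactSpace RegMobiusZero := (isotropyHomeomorph h).compactSpace
  have := h.manifold
  have := h.hausdorff
  have htriv := isGloballyTrivial_inverseOrbit h hρ hρ'
  exact ⟨charts, isSmoothEmbedding_coe_regMobiusZero h hρ hρ',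
    ⟨isotropyEquiv, isotropyEquiv_apply, hρ, hρ'⟩, htriv.isLeftPrincipalBundle, htriv⟩
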